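/- **Language.** Let $\Sigma$ be a signature consisting of uninterpreted symbols of arbitrary arity and of binary symbols, each of which is associative (A), commutative (C) or associative-commutative (AC); $E$ is the set of the corresponding identities (so $E=\emptyset$, $A$, $C$, $AC$ are the cases where no binary symbol is interpreted, resp. where all interpreted symbols are of the one kind). *Ground terms* are $S::=a\mid f(S_1,\dots,S_n)\mid\lambda a.S$ over a countably infinite set of atoms $a$; $a\#S$ means that $a$ is not free in $S$, and $\approx_E$ is the congruence generated by $\alpha$-equivalence and $E$. *NLA-terms* are given by $s::=W\mid\pi\cdot X\mid f(s_1,\dots,s_n)\mid\lambda W.s$ with $W::=\pi\cdot A$ and $\pi::=\mathrm{id}\mid(W_1\,W_2)\circ\pi$, where $A$ ranges over atom-variables and $X$ over term-variables; $\pi\cdot s$ is defined by pushing $\pi$ to the suspensions. A *freshness context* is a finite set of constraints $W\#s$. An *interpretation* $\rho$ maps atom-variables to atoms and term-variables to ground terms, and extends homomorphically. $\Gamma\models s\approx_E t$ means that $s\rho\approx_E t\rho$ for every $\rho$ such that all constraints of $\Gamma\rho$ hold. Put $[\![\Gamma,s]\!]=\{[s\rho]_{\approx_E}\mid \Gamma\rho\text{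 holds}\}$. The term-in-context $(\Gamma,r)$ is an *$E$-generalization* of $(\nabla,t)$ and $(\nabla,s)$ if $[\![\nabla,t]\!]\subseteq[\![\Gamma,r]\!]$ and $[\![\nabla,s]\!]\subseteq[\![\Gamma,r]\!]$. **The algorithm N-AU$_E$.** States are $P;S;\Gamma;\sigma$ with $P$, $S$ sets of equations, $\Gamma$ a freshness context and $\sigma$ a substitution, applied on the right ($t(\sigma\gamma)=(t\sigma)\gamma$). Terms headed by an A- or AC-symbol $f$ are read in flattened form $f(t_1,\dots,t_n)$, $n\ge2$, and $f(t)$ stands for $t$. Variables $Y,Y_i$ (term-variables) and $C$ (atom-variables) introduced by a rule are distinct and fresh: they occur neither in the input nor in the current state. A rule removes the displayed equation from $P$: * Dec: $X:f(t_1,\dots,t_m)\triangleq f(s_1,\dots,s_m)$ is replaced by $Y_i:t_i\triangleq s_i$ ($1\le i\le m$), and $\sigma$ by $\sigma\{X\mapsto f(Y_1,\dots,Y_m)\}$ ($f\in\Sigma$). * Abs: $X:\lambda W_1.t\triangleq\lambda W_2.s$ is replaced by $Y:(W_1\,C)\cdot t\triangleq(W_2\,C)\cdot s$, the constraints $C\#\lambda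 W_1.t$, $C\#\lambda W_2.s$ are added to $\Gamma$, and $\sigma$ becomes $\sigma\{X\mapsto\lambda C.Y\}$. * SusAA: $X:W_1\triangleq W_2$ is removed if $\Gamma\models W_1\approx_E W_2$; $\sigma$ becomes $\sigma\{X\mapsto W_1\}$. * SusYY: $X:\pi_1\cdot Y\triangleq\pi_2\cdot Y$ is removed if $\Gamma\models\pi_1\cdot Y\approx_E\pi_2\cdot Y$; $\sigma$ becomes $\sigma\{X\mapsto\pi_1\cdot Y\}$. * SolAB: if $\Gamma\not\models W_1\approx_E W_2$, then $X:W_1\triangleq W_2$ is removed, $C:W_1\triangleq W_2$ is added to $S$, $C\#\lambda W_1.\lambda W_2.C$ to $\Gamma$, and $\sigma$ becomes $\sigma\{X\mapsto C\}$. * Sol: an equation to which none of the other rules for $P$ applies is moved from $P$ to $S$. * DecA ($f$ an A-symbol): $X:f(t_1,\dots,t_n)\triangleq f(s_1,\dots,s_m)$ is replaced by $Y_1:f(t_1,\dots,t_k)\triangleq f(s_1,\dots,s_l)$ and $Y_2:f(t_{k+1},\dots,t_n)\triangleq f(s_{l+1},\dots,s_m)$ for some $1\le k<n$, $1\le l<m$;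 $\sigma$ becomes $\sigma\{X\mapsto f(Y_1,Y_2)\}$. * DecC ($f$ a C-symbol): $X:f(t_1,t_2)\triangleq f(s_1,s_2)$ is replaced by $Y_1:t_1\triangleq s_i$ and $Y_2:t_2\triangleq s_{3-i}$, $i\in\{1,2\}$; $\sigma$ becomes $\sigma\{X\mapsto f(Y_1,Y_2)\}$. * DecAC ($f$ an AC-symbol): as DecA, after arbitrary reorderings of $t_1,\dots,t_n$ and of $s_1,\dots,s_m$. * Mer: if $P=\emptyset$ and $S$ contains two different equations $Z_1:t_1\triangleq s_1$ and $Z_2:t_2\triangleq s_2$, with $Z_1,Z_2$ both term-variables or both atom-variables, then the second one is removed, and $\Gamma,\sigma$ become $\Gamma\{Z_2\mapsto\pi\cdot Z_1\}$, $\sigma\{Z_2\mapsto\pi\cdot Z_1\}$, where $\pi$ is a result of EqVM on $\{t_1\preccurlyeq t_2,\ s_1\preccurlyeq s_2\}$ and $\Gamma$. **EqVM** is the following non-deterministic procedure; an equation $t\preccurlyeq s$ asks for $\pi\cdot t\approx_E s$. The context is written as an equivalent finite disjunction of finite contexts consisting of constraints $A\#B$, $A\#X$, $A\#\lambda B.A$;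 $\pi$ is a result if for each disjunct $\Delta$ some run on it answers $\pi$. A run decomposes the equations exhaustively: $\lambda W_1.t\preccurlyeq\lambda W_2.s$ into $(W_1\,A)\cdot t\preccurlyeq(W_2\,A)\cdot s$ and $A\preccurlyeq A$ with a fresh atom-variable $A$, adding to $\Delta$ the constraints $A\#B$, $A\#X$ for all other variables $B,X$ occurring; $f(t_1,\dots,t_k)\preccurlyeq f(s_1,\dots,s_k)$ into $t_j\preccurlyeq s_j$ for $f$ uninterpreted or (flattened) an A-symbol; $f(t_1,t_2)\preccurlyeq f(s_1,s_2)$ into $t_1\preccurlyeq s_i$, $t_2\preccurlyeq s_{3-i}$ for a C-symbol; $f(t_1,\dots,t_n)\preccurlyeq f(s_1,\dots,s_n)$ into $t_1\preccurlyeq s_i$ and $f(t_2,\dots,t_n)\preccurlyeq f(s_1,\dots,s_{i-1},s_{i+1},\dots,s_n)$ for an AC-symbol. It fails if an equation other than $\pi_1\cdot A\preccurlyeq\pi_2\cdot B$ or $\pi_1\cdot X\preccurlyeq\pi_2\cdot X$ remains; otherwise it answers with a permutation $\pi$ that does not mention the fresh atom-variables $A$ and satisfies $\Delta\models\pi\cdot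 l\approx_E r$ for every remaining equation $l\preccurlyeq r$ and the extended context $\Delta$. **Theorem (Soundness).** Let $(\nabla,t)$ and $(\nabla,s)$ be NLA terms-in-context and let $X$ be a term-variable that occurs neither in $\nabla$ nor in $t$ nor in $s$. Let $\Gamma_0$ be $\emptyset$ or $\nabla$. If there is a derivation $$\{X:t\triangleq s\};\emptyset;\Gamma_0;\mathrm{Id}\Longrightarrow^{+}\emptyset;S;\Gamma;\sigma$$ of N-AU$_E$, then $(\Gamma,X\sigma)$ is an $E$-generalization of $(\nabla,t)$ and $(\nabla,s)$. -/

import Mathlib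

namespace NLA

universe u

/-! ### Signatures, ground terms and equality modulo `E` -/

/-- The theories a binary function symbol may carry: associativity, commutativity, both. -/
inductive BinTheory where
  | A
  | C
  | AC

/-- A signature: uninterpreted symbols of arbitrary arity, and binary symbols, each of which is
associative, commutative, or associative-commutative. The theory `E` is given by the signature:
`E = ∅` if `Bin` is empty, `E = A` if all symbols in `Bin` carry `A`, and so on. -/
structure Signature where
  Free : Type u
  arity : Free → ℕ
  Bin : Type u
  theory : Bin → BinTheory

/-- Concrete atoms. -/
abbrev Atom := ℕ
/-- Atom-variables. -/
abbrev AVar := ℕ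
/-- Term-variables. -/
abbrev TVar := ℕ

/-- Ground terms (with all permutations carried out). -/
inductive GTerm (Sg : Signature.{u}) where
  | atom (a : Atom)
  | app (f : Sg.Free) (args : Fin (Sg.arity f) → GTerm Sg)
  | bin (f : Sg.Bin) (S T : GTerm Sg)
  | lam (a : Atom) (S : GTerm Sg)

/-- Action of a permutation of atoms on ground terms. -/
def GTerm.act {Sg : Signature.{u}} (p : Equiv.Perm Atom) : GTerm Sg → GTerm Sg
  | .atom a => .atom (p a)
  | .app f args => .app f (fun i => (args i).act p)
  | .bin f S T => .bin f (S.act p) (T.act p)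
  | .lam a S => .lam (p a) (S.act p)

/-- Ground freshness `a # T`. -/
inductive GFresh {Sg : Signature.{u}} (a : Atom) : GTerm Sg → Prop where
  | atom (b : Atom) (h : a ≠ b) : GFresh a (.atom b)
  | app (f : Sg.Free) (args : Fin (Sg.arity f) → GTerm Sg) (h : ∀ i, GFresh a (args i)) :
      GFresh a (.app f args)
  | bin (f : Sg.Bin) (S T : GTerm Sg) (hS : GFresh a S) (hT : GFresh a T) :
      GFresh a (.bin f S T)
  | lamSame (T : GTerm Sg) : GFresh a (.lam a T)
  | lam (b : Atom) (T : GTerm Sg) (h : GFresh a T) : GFresh a (.lam b T)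

/-- `S ≈_E T`: the equivalence relation generated by the rules of alpha-equivalence (which make
it a congruence) and the identities of `E`. -/
inductive EqE {Sg : Signature.{u}} : GTerm Sg → GTerm Sg → Prop where
  | atom (a : Atom) : EqE (.atom a) (.atom a)
  | app (f : Sg.Free) (S T : Fin (Sg.arity f) → GTerm Sg) (h : ∀ i, EqE (S i) (T i)) :
      EqE (.app f S) (.app f T)
  | bin (f : Sg.Bin) (S₁ S₂ T₁ T₂ : GTerm Sg) (h₁ : EqE S₁ T₁) (h₂ : EqE S₂ T₂) :
      EqE (.bin f S₁ S₂) (.bin f T₁ T₂)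
  | lamSame (a : Atom) (S T : GTerm Sg) (h : EqE S T) : EqE (.lam a S) (.lam a T)
  | lam (a b : Atom) (S T : GTerm Sg) (h : EqE S (T.act (Equiv.swap a b))) (hf : GFresh a T) :
      EqE (.lam a S) (.lam b T)
  | comm (f : Sg.Bin) (hf : Sg.theory f = .C ∨ Sg.theory f = .AC) (S T : GTerm Sg) :
      EqE (.bin f S T) (.bin f T S)
  | assoc (f : Sg.Bin) (hf : Sg.theory f = .A ∨ Sg.theory f = .AC) (S T R : GTerm Sg) :
      EqE (.bin f (.bin f S T) R) (.bin f S (.bin f T R))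
  | symm (S T : GTerm Sg) (h : EqE S T) : EqE T S
  | trans (S T R : GTerm Sg) (h₁ : EqE S T) (h₂ : EqE T R) : EqE S R

theorem EqE.refl {Sg : Signature.{u}} (S : GTerm Sg) : EqE S S := by
  induction S with
  | atom a => exact .atom a
  | app f args ih => exact .app f _ _ ih
  | bin f S T ihS ihT => exact .bin f _ _ _ _ ihS ihT
  | lam a S ih => exact .lamSame a _ _ ih

/-- Ground terms modulo `≈_E`. -/
def eqESetoid (Sg : Signature.{u}) : Setoid (GTerm Sg) where
  r := EqE
  iseqv := ⟨EqE.refl, fun h => .symm _ _ h, fun h₁ h₂ => .trans _ _ _ h₁ h₂⟩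

/-! ### Terms with atom-variables -/

mutual
/-- Atom-variable permutations `π ::= id | (W₁ W₂) ∘ π`. -/
inductive Perm where
  | id
  | swap (W₁ W₂ : Susp) (π : Perm)
/-- Atom-variable suspensions `W ::= π · A`. -/
inductive Susp where
  | mk (π : Perm) (A : AVar)
end

/-- NLA-terms `s ::= W | π · X | f(s₁, …, sₙ) | λ W. s`. -/
inductive Term (Sg : Signature.{u}) where
  | susp (W : Susp)
  | var (π : Perm) (X : TVar)
  | app (f : Sg.Free) (args : Fin (Sg.arity f) → Term Sg)
  | bin (f : Sg.Bin) (s t : Term Sg)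
  | lam (W : Susp) (s : Term Sg)

/-- The suspension `id · A`, written `A`. -/
def Susp.ofVar (A : AVar) : Susp := .mk .id A

/-- The swapping `(W₁ W₂)`. -/
def Perm.swapping (W₁ W₂ : Susp) : Perm := .swap W₁ W₂ .id

/-- Composition `π ∘ π'`. -/
def Perm.comp : Perm → Perm → Perm
  | .id, π' => π'
  | .swap W₁ W₂ π, π' => .swap W₁ W₂ (π.comp π')

/-- `π · W`. -/
def Susp.act (π : Perm) : Susp → Susp
  | .mk π' A => .mk (π.comp π') A

section Terms

variable {Sg : Signature.{u}}

/-- `π · s`. -/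
def Term.act (π : Perm) : Term Sg → Term Sg
  | .susp W => .susp (W.act π)
  | .var π' X => .var (π.comp π') X
  | .app f args => .app f (fun i => (args i).act π)
  | .bin f s t => .bin f (s.act π) (t.act π)
  | .lam W s => .lam (W.act π) (s.act π)

mutual
/-- Atom-variables of a permutation. -/
def Perm.av : Perm → Set AVar
  | .id => ∅
  | .swap W₁ W₂ π => W₁.av ∪ W₂.av ∪ π.av
/-- Atom-variables of a suspension. -/
def Susp.av : Susp → Set AVar
  | .mk π A => insert A π.av
end

/-- Atom-variables of a term. -/
def Term.av : Term Sg → Set AVar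
  | .susp W => W.av
  | .var π _ => π.av
  | .app _ args => ⋃ i, (args i).av
  | .bin _ s t => s.av ∪ t.av
  | .lam W s => W.av ∪ s.av

/-- Term-variables of a term. -/
def Term.tv : Term Sg → Set TVar
  | .susp _ => ∅
  | .var _ X => {X}
  | .app _ args => ⋃ i, (args i).tv
  | .bin _ s t => s.tv ∪ t.tv
  | .lam _ s => s.tv

open Classical in
/-- The list of arguments `t₁, …, tₙ` of the flattened form `f(t₁, …, tₙ)` of a term with respect
to the symbol `f`; if `t` is not headed by `f`, then `n = 1` and `t₁ = t`. -/
noncomputable def Term.flat (f : Sg.Bin) : Term Sg → List (Term Sg)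
  | .bin g s t => if g = f then s.flat f ++ t.flat f else [.bin g s t]
  | .susp W => [.susp W]
  | .var π X => [.var π X]
  | .app g args => [.app g args]
  | .lam W s => [.lam W s]

/-! ### Substitutions -/

/-- Maps from term-variables to terms and from atom-variables to suspensions. Only the identity
and compositions of it with single bindings are used, which have a finite domain. -/
structure Subst (Sg : Signature.{u}) where
  onT : TVar → Term Sg
  onA : AVar → Susp

mutual
/-- `π σ`. -/
def Perm.subst (σ : Subst Sg) : Perm → Perm
  | .id => .id
  | .swap W₁ W₂ π => .swap (W₁.subst σ) (W₂.subst σ) (π.subst σ)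
/-- `W σ`. -/
def Susp.subst (σ : Subst Sg) : Susp → Susp
  | .mk π A => (σ.onA A).act (π.subst σ)
end

/-- `s σ`. -/
def Term.subst (σ : Subst Sg) : Term Sg → Term Sg
  | .susp W => .susp (W.subst σ)
  | .var π X => (σ.onT X).act (π.subst σ)
  | .app f args => .app f (fun i => (args i).subst σ)
  | .bin f s t => .bin f (s.subst σ) (t.subst σ)
  | .lam W s => .lam (W.subst σ) (s.subst σ)

/-- The identity substitution. -/
def Subst.id : Subst Sg := ⟨fun X => .var .id X, fun A => .ofVar A⟩

/-- The substitution `{X ↦ r}`. -/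
def Subst.singleT (X : TVar) (r : Term Sg) : Subst Sg :=
  ⟨Function.update (Subst.id (Sg := Sg)).onT X r, (Subst.id (Sg := Sg)).onA⟩

/-- The substitution `{C ↦ W}`. -/
def Subst.singleA (C : AVar) (W : Susp) : Subst Sg :=
  ⟨(Subst.id (Sg := Sg)).onT, Function.update (Subst.id (Sg := Sg)).onA C W⟩

/-- The composition `σ γ`, with `t (σ γ) = (t σ) γ`. -/
def Subst.comp (σ γ : Subst Sg) : Subst Sg :=
  ⟨fun X => (σ.onT X).subst γ, fun A => (σ.onA A).subst γ⟩

/-- Atom-variables in the domain or in the range of `σ`. -/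
def Subst.av (σ : Subst Sg) : Set AVar :=
  {A | σ.onA A ≠ .ofVar A} ∪ {A | ∃ B, σ.onA B ≠ .ofVar B ∧ A ∈ (σ.onA B).av} ∪
    {A | ∃ X, A ∈ (σ.onT X).av}

/-- Term-variables in the domain or in the range of `σ`. -/
def Subst.tv (σ : Subst Sg) : Set TVar :=
  {X | σ.onT X ≠ .var .id X} ∪ {X | ∃ Z, σ.onT Z ≠ .var .id Z ∧ X ∈ (σ.onT Z).tv}

/-! ### Freshness constraints, interpretations and judgements -/

/-- The freshness constraint `W # s`. -/
structure Constraint (Sg : Signature.{u}) where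
  W : Susp
  s : Term Sg

/-- Freshness contexts, as sets of constraints; finiteness is stated where it is needed. -/
abbrev Ctx (Sg : Signature.{u}) := Set (Constraint Sg)

def Constraint.subst (σ : Subst Sg) (c : Constraint Sg) : Constraint Sg :=
  ⟨c.W.subst σ, c.s.subst σ⟩

/-- `Γ σ`. -/
def Ctx.subst (σ : Subst Sg) (Γ : Ctx Sg) : Ctx Sg := Constraint.subst σ '' Γ

def Ctx.av (Γ : Ctx Sg) : Set AVar := {A | ∃ c ∈ Γ, A ∈ c.W.av ∪ c.s.av}

def Ctx.tv (Γ : Ctx Sg) : Set TVar := {X | ∃ c ∈ Γ, X ∈ c.s.tv}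

/-- An interpretation is determined by atoms for the atom-variables and ground terms for the
term-variables. -/
structure Interp (Sg : Signature.{u}) where
  onA : AVar → Atom
  onT : TVar → GTerm Sg

mutual
/-- `π ρ`. -/
def Perm.interp (ρ : Interp Sg) : Perm → Equiv.Perm Atom
  | .id => 1
  | .swap W₁ W₂ π => Equiv.swap (W₁.interp ρ) (W₂.interp ρ) * π.interp ρ
/-- `W ρ`. -/
def Susp.interp (ρ : Interp Sg) : Susp → Atom
  | .mk π A => π.interp ρ (ρ.onA A)
end

/-- `s ρ`. -/
def Term.interp (ρ : Interp Sg) : Term Sg → GTerm Sg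
  | .susp W => .atom (W.interp ρ)
  | .var π X => (ρ.onT X).act (π.interp ρ)
  | .app f args => .app f (fun i => (args i).interp ρ)
  | .bin f s t => .bin f (s.interp ρ) (t.interp ρ)
  | .lam W s => .lam (W.interp ρ) (s.interp ρ)

/-- `Γ ρ` holds. -/
def Interp.Respects (ρ : Interp Sg) (Γ : Ctx Sg) : Prop :=
  ∀ c ∈ Γ, GFresh (c.W.interp ρ) (c.s.interp ρ)

/-- The judgement `Γ ⊨ s ≈_E t`. -/
def Entails (Γ : Ctx Sg) (s t : Term Sg) : Prop :=
  ∀ ρ : Interp Sg, ρ.Respects Γ → EqE (s.interp ρ) (t.interp ρ)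

/-- The semantics of the term-in-context `(Γ, s)`: the set of the classes modulo `≈_E` of the
instances of `s` under the interpretations respecting `Γ`. -/
def sem (Γ : Ctx Sg) (s : Term Sg) : Set (Quotient (eqESetoid Sg)) :=
  {q | ∃ ρ : Interp Sg, ρ.Respects Γ ∧ q = Quotient.mk (eqESetoid Sg) (s.interp ρ)}

/-- `(Γ, r)` is more general than `(Δ, s)`. -/
def MoreGeneral (Γ : Ctx Sg) (r : Term Sg) (Δ : Ctx Sg) (s : Term Sg) : Prop :=
  sem Δ s ⊆ sem Γ r

/-- `(Γ, r)` is an `E`-generalization of `(Δ₁, t)` and `(Δ₂, s)`. -/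
def IsGeneralization (Γ : Ctx Sg) (r : Term Sg) (Δ₁ : Ctx Sg) (t : Term Sg)
    (Δ₂ : Ctx Sg) (s : Term Sg) : Prop :=
  MoreGeneral Γ r Δ₁ t ∧ MoreGeneral Γ r Δ₂ s

/-! ### The equivariance algorithm -/

/-- A set of equivariance equations `t ≼ s`, to be solved by a permutation `π` with
`π · t ≈_E s`. -/
abbrev EqvProblem (Sg : Signature.{u}) := Set (Term Sg × Term Sg)

def EqvProblem.av (Ψ : EqvProblem Sg) : Set AVar := {A | ∃ e ∈ Ψ, A ∈ e.1.av ∪ e.2.av}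

def EqvProblem.tv (Ψ : EqvProblem Sg) : Set TVar := {X | ∃ e ∈ Ψ, X ∈ e.1.tv ∪ e.2.tv}

/-- The equations in which nothing is left to decompose and which do not make the algorithm fail:
`π₁ · A ≼ π₂ · B` and `π₁ · X ≼ π₂ · X`. -/
inductive EqvSolvedForm : Term Sg × Term Sg → Prop where
  | susp (W₁ W₂ : Susp) : EqvSolvedForm (.susp W₁, .susp W₂)
  | var (π₁ π₂ : Perm) (X : TVar) : EqvSolvedForm (.var π₁ X, .var π₂ X)

/-- `Eqvm π Ψ Δ`: some run of the equivariance algorithm on the equations `Ψ` and the freshness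
context `Δ` ends with the answer `π`. A run decomposes the equations completely; the answer has to
solve the remaining equations between suspensions and must not mention the atom-variables that
were introduced for abstractions. -/
inductive Eqvm (π : Perm) : EqvProblem Sg → Ctx Sg → Prop where
  | answer (Ψ : EqvProblem Sg) (Δ : Ctx Sg) (hΨ : ∀ e ∈ Ψ, EqvSolvedForm e)
      (hπ : ∀ e ∈ Ψ, Entails Δ (e.1.act π) e.2) : Eqvm π Ψ Δ
  | eqAbs (W₁ W₂ : Susp) (t s : Term Sg) (Ψ : EqvProblem Sg) (Δ : Ctx Sg) (A : AVar)
      (hd : (Term.lam W₁ t, Term.lam W₂ s) ∉ Ψ)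
      (hA : A ∉ EqvProblem.av (insert (Term.lam W₁ t, Term.lam W₂ s) Ψ) ∪ Ctx.av Δ)
      (hAπ : A ∉ π.av)
      (h : Eqvm π
        (insert (t.act (.swapping W₁ (.ofVar A)), s.act (.swapping W₂ (.ofVar A)))
          (insert (.susp (.ofVar A), .susp (.ofVar A)) Ψ))
        ({c | ∃ B ∈ EqvProblem.av (insert (Term.lam W₁ t, Term.lam W₂ s) Ψ) ∪ Ctx.av Δ,
              c = ⟨.ofVar A, .susp (.ofVar B)⟩} ∪
          {c | ∃ X ∈ EqvProblem.tv (insert (Term.lam W₁ t, Term.lam W₂ s) Ψ) ∪ Ctx.tv Δ,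
              c = ⟨.ofVar A, .var .id X⟩} ∪ Δ)) :
      Eqvm π (insert (.lam W₁ t, .lam W₂ s) Ψ) Δ
  | eqf (f : Sg.Free) (t s : Fin (Sg.arity f) → Term Sg) (Ψ : EqvProblem Sg) (Δ : Ctx Sg)
      (hd : (Term.app f t, Term.app f s) ∉ Ψ)
      (h : Eqvm π (Set.range (fun j => (t j, s j)) ∪ Ψ) Δ) :
      Eqvm π (insert (.app f t, .app f s) Ψ) Δ
  | eqfA (f : Sg.Bin) (hf : Sg.theory f = .A) (k : ℕ) (hk : 2 ≤ k) (t s : Term Sg)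
      (ts ss : Fin k → Term Sg) (ht : t.flat f = List.ofFn ts) (hs : s.flat f = List.ofFn ss)
      (Ψ : EqvProblem Sg) (Δ : Ctx Sg) (hd : (t, s) ∉ Ψ)
      (h : Eqvm π (Set.range (fun j => (ts j, ss j)) ∪ Ψ) Δ) :
      Eqvm π (insert (t, s) Ψ) Δ
  | eqfC₁ (f : Sg.Bin) (hf : Sg.theory f = .C) (t₁ t₂ s₁ s₂ : Term Sg)
      (Ψ : EqvProblem Sg) (Δ : Ctx Sg) (hd : (Term.bin f t₁ t₂, Term.bin f s₁ s₂) ∉ Ψ)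
      (h : Eqvm π (insert (t₁, s₁) (insert (t₂, s₂) Ψ)) Δ) :
      Eqvm π (insert (.bin f t₁ t₂, .bin f s₁ s₂) Ψ) Δ
  | eqfC₂ (f : Sg.Bin) (hf : Sg.theory f = .C) (t₁ t₂ s₁ s₂ : Term Sg)
      (Ψ : EqvProblem Sg) (Δ : Ctx Sg) (hd : (Term.bin f t₁ t₂, Term.bin f s₁ s₂) ∉ Ψ)
      (h : Eqvm π (insert (t₁, s₂) (insert (t₂, s₁) Ψ)) Δ) :
      Eqvm π (insert (.bin f t₁ t₂, .bin f s₁ s₂) Ψ) Δ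
  /- Here `t' = f(t₂, …, tₙ)`, `s' = f(s₁, …, sᵢ₋₁, sᵢ₊₁, …, sₙ)`, up to bracketing. -/
  | eqfAC (f : Sg.Bin) (hf : Sg.theory f = .AC) (t s t₁ sᵢ t' s' : Term Sg)
      (l₁ l₂ : List (Term Sg))
      (hlen : (t.flat f).length = (s.flat f).length)
      (ht : t.flat f = t₁ :: t'.flat f)
      (hs : s.flat f = l₁ ++ sᵢ :: l₂) (hs' : s'.flat f = l₁ ++ l₂)
      (Ψ : EqvProblem Sg) (Δ : Ctx Sg) (hd : (t, s) ∉ Ψ)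
      (h : Eqvm π (insert (t₁, sᵢ) (insert (t', s') Ψ)) Δ) :
      Eqvm π (insert (t, s) Ψ) Δ

/-- Simple constraints `A # B`, `A # X` and `A # λ B. A` (the last one says `A = B`). -/
inductive Constraint.Simple : Constraint Sg → Prop where
  | atom (A B : AVar) : Constraint.Simple ⟨.ofVar A, .susp (.ofVar B)⟩
  | var (A : AVar) (X : TVar) : Constraint.Simple ⟨.ofVar A, .var .id X⟩
  | eq (A B : AVar) : Constraint.Simple ⟨.ofVar A, .lam (.ofVar B) (.susp (.ofVar A))⟩

/-- `π` is a possible result of the equivariance algorithm on `Ψ` and an arbitrary context `Γ`: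
the context is split into an equivalent finite disjunction of simple contexts, and `π` is an
answer for each of them. -/
def EqvmResult (Ψ : EqvProblem Sg) (Γ : Ctx Sg) (π : Perm) : Prop :=
  ∃ D : List (Ctx Sg),
    (∀ Δ ∈ D, Δ.Finite ∧ ∀ c ∈ Δ, c.Simple) ∧
    (∀ ρ : Interp Sg, ρ.Respects Γ ↔ ∃ Δ ∈ D, ρ.Respects Δ) ∧
    ∀ Δ ∈ D, Eqvm π Ψ Δ

/-! ### The anti-unification algorithm -/

/-- An unsolved anti-unification equation `X : t ≜ s`. -/
structure AUEq (Sg : Signature.{u}) where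
  X : TVar
  t : Term Sg
  s : Term Sg

/-- A solved anti-unification equation in the store, `X : t ≜ s` or `C : W₁ ≜ W₂`. -/
inductive StoreEq (Sg : Signature.{u}) where
  | term (X : TVar) (t s : Term Sg)
  | atom (C : AVar) (W₁ W₂ : Susp)

def AUEq.av (e : AUEq Sg) : Set AVar := e.t.av ∪ e.s.av

def AUEq.tv (e : AUEq Sg) : Set TVar := insert e.X (e.t.tv ∪ e.s.tv)

def StoreEq.av : StoreEq Sg → Set AVar
  | .term _ t s => t.av ∪ s.av
  | .atom C W₁ W₂ => insert C (W₁.av ∪ W₂.av)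

def StoreEq.tv : StoreEq Sg → Set TVar
  | .term X t s => insert X (t.tv ∪ s.tv)
  | .atom _ _ _ => ∅

/-- States `P; S; Γ; σ`. -/
structure State (Sg : Signature.{u}) where
  P : Set (AUEq Sg)
  S : Set (StoreEq Sg)
  Γ : Ctx Sg
  σ : Subst Sg

def State.av (st : State Sg) : Set AVar :=
  {A | ∃ e ∈ st.P, A ∈ e.av} ∪ {A | ∃ e ∈ st.S, A ∈ e.av} ∪ Ctx.av st.Γ ∪ st.σ.av

def State.tv (st : State Sg) : Set TVar :=
  {X | ∃ e ∈ st.P, X ∈ e.tv} ∪ {X | ∃ e ∈ st.S, X ∈ e.tv} ∪ Ctx.tv st.Γ ∪ st.σ.tv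

/-- The input of the algorithm: the equation `X : t ≜ s` and the freshness context `Δ`. It is a
global parameter of a derivation; the names in it are never used as fresh names. -/
structure Input (Sg : Signature.{u}) where
  Δ : Ctx Sg
  eqn : AUEq Sg

/-- `Y` is a fresh term-variable in the state `st`. -/
def FreshT (I : Input Sg) (st : State Sg) (Y : TVar) : Prop :=
  Y ∉ Ctx.tv I.Δ ∧ Y ∉ I.eqn.tv ∧ Y ∉ st.tv

/-- `C` is a fresh atom-variable in the state `st`. -/
def FreshA (I : Input Sg) (st : State Sg) (C : AVar) : Prop :=
  C ∉ Ctx.av I.Δ ∧ C ∉ I.eqn.av ∧ C ∉ st.av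

/-- One of the rules other than `Sol` applies to an unsolved equation `X : t ≜ s`. -/
inductive Reducible (Γ : Ctx Sg) : Term Sg → Term Sg → Prop where
  | app (f : Sg.Free) (t s : Fin (Sg.arity f) → Term Sg) : Reducible Γ (.app f t) (.app f s)
  | bin (f : Sg.Bin) (t₁ t₂ s₁ s₂ : Term Sg) : Reducible Γ (.bin f t₁ t₂) (.bin f s₁ s₂)
  | lam (W₁ W₂ : Susp) (t s : Term Sg) : Reducible Γ (.lam W₁ t) (.lam W₂ s)
  | susp (W₁ W₂ : Susp) : Reducible Γ (.susp W₁) (.susp W₂)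
  | var (π₁ π₂ : Perm) (Y : TVar) (h : Entails Γ (.var π₁ Y) (.var π₂ Y)) :
      Reducible Γ (.var π₁ Y) (.var π₂ Y)

/-- The steps `P; S; Γ; σ ⟹ P'; S'; Γ'; σ'` of the algorithm on the input `I`. -/
inductive Step (I : Input Sg) : State Sg → State Sg → Prop where
  /- Decomposition for an uninterpreted symbol. -/
  | dec (X : TVar) (f : Sg.Free) (t s : Fin (Sg.arity f) → Term Sg) (P : Set (AUEq Sg))
      (S : Set (StoreEq Sg)) (Γ : Ctx Sg) (σ : Subst Sg) (Y : Fin (Sg.arity f) → TVar)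
      (hd : (⟨X, .app f t, .app f s⟩ : AUEq Sg) ∉ P)
      (hinj : Function.Injective Y)
      (hY : ∀ i, FreshT I ⟨insert ⟨X, .app f t, .app f s⟩ P, S, Γ, σ⟩ (Y i)) :
      Step I ⟨insert ⟨X, .app f t, .app f s⟩ P, S, Γ, σ⟩
        ⟨Set.range (fun i => (⟨Y i, t i, s i⟩ : AUEq Sg)) ∪ P, S, Γ,
          σ.comp (.singleT X (.app f (fun i => .var .id (Y i))))⟩
  /- Decomposition for an associative symbol applied to equally many arguments
  (in flattened form); `r` is `f(Y₁, …, Yₘ)`. -/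
  | decFlat (X : TVar) (f : Sg.Bin) (hf : Sg.theory f = .A ∨ Sg.theory f = .AC)
      (m : ℕ) (hm : 2 ≤ m) (t s r : Term Sg) (ts ss : Fin m → Term Sg) (P : Set (AUEq Sg))
      (S : Set (StoreEq Sg)) (Γ : Ctx Sg) (σ : Subst Sg) (Y : Fin m → TVar)
      (ht : t.flat f = List.ofFn ts) (hs : s.flat f = List.ofFn ss)
      (hr : r.flat f = List.ofFn (fun i => Term.var .id (Y i)))
      (hd : (⟨X, t, s⟩ : AUEq Sg) ∉ P)
      (hinj : Function.Injective Y)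
      (hY : ∀ i, FreshT I ⟨insert ⟨X, t, s⟩ P, S, Γ, σ⟩ (Y i)) :
      Step I ⟨insert ⟨X, t, s⟩ P, S, Γ, σ⟩
        ⟨Set.range (fun i => (⟨Y i, ts i, ss i⟩ : AUEq Sg)) ∪ P, S, Γ, σ.comp (.singleT X r)⟩
  | abs (X : TVar) (W₁ W₂ : Susp) (t s : Term Sg) (P : Set (AUEq Sg))
      (S : Set (StoreEq Sg)) (Γ : Ctx Sg) (σ : Subst Sg) (Y : TVar) (C : AVar)
      (hd : (⟨X, .lam W₁ t, .lam W₂ s⟩ : AUEq Sg) ∉ P)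
      (hY : FreshT I ⟨insert ⟨X, .lam W₁ t, .lam W₂ s⟩ P, S, Γ, σ⟩ Y)
      (hC : FreshA I ⟨insert ⟨X, .lam W₁ t, .lam W₂ s⟩ P, S, Γ, σ⟩ C) :
      Step I ⟨insert ⟨X, .lam W₁ t, .lam W₂ s⟩ P, S, Γ, σ⟩
        ⟨insert ⟨Y, t.act (.swapping W₁ (.ofVar C)), s.act (.swapping W₂ (.ofVar C))⟩ P, S,
          Γ ∪ {⟨.ofVar C, .lam W₁ t⟩, ⟨.ofVar C, .lam W₂ s⟩},
          σ.comp (.singleT X (.lam (.ofVar C) (.var .id Y)))⟩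
  | susAA (X : TVar) (W₁ W₂ : Susp) (P : Set (AUEq Sg))
      (S : Set (StoreEq Sg)) (Γ : Ctx Sg) (σ : Subst Sg)
      (hd : (⟨X, .susp W₁, .susp W₂⟩ : AUEq Sg) ∉ P)
      (h : Entails Γ (.susp W₁) (.susp W₂)) :
      Step I ⟨insert ⟨X, .susp W₁, .susp W₂⟩ P, S, Γ, σ⟩
        ⟨P, S, Γ, σ.comp (.singleT X (.susp W₁))⟩
  | susYY (X : TVar) (π₁ π₂ : Perm) (Y : TVar) (P : Set (AUEq Sg))
      (S : Set (StoreEq Sg)) (Γ : Ctx Sg) (σ : Subst Sg)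
      (hd : (⟨X, .var π₁ Y, .var π₂ Y⟩ : AUEq Sg) ∉ P)
      (h : Entails Γ (.var π₁ Y) (.var π₂ Y)) :
      Step I ⟨insert ⟨X, .var π₁ Y, .var π₂ Y⟩ P, S, Γ, σ⟩
        ⟨P, S, Γ, σ.comp (.singleT X (.var π₁ Y))⟩
  | solAB (X : TVar) (W₁ W₂ : Susp) (P : Set (AUEq Sg))
      (S : Set (StoreEq Sg)) (Γ : Ctx Sg) (σ : Subst Sg) (C : AVar)
      (hd : (⟨X, .susp W₁, .susp W₂⟩ : AUEq Sg) ∉ P)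
      (h : ¬ Entails Γ (.susp W₁) (.susp W₂))
      (hC : FreshA I ⟨insert ⟨X, .susp W₁, .susp W₂⟩ P, S, Γ, σ⟩ C) :
      Step I ⟨insert ⟨X, .susp W₁, .susp W₂⟩ P, S, Γ, σ⟩
        ⟨P, S ∪ {.atom C W₁ W₂},
          Γ ∪ {⟨.ofVar C, .lam W₁ (.lam W₂ (.susp (.ofVar C)))⟩},
          σ.comp (.singleT X (.susp (.ofVar C)))⟩
  | sol (X : TVar) (t s : Term Sg) (P : Set (AUEq Sg))
      (S : Set (StoreEq Sg)) (Γ : Ctx Sg) (σ : Subst Sg)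
      (hd : (⟨X, t, s⟩ : AUEq Sg) ∉ P)
      (h : ¬ Reducible Γ t s) :
      Step I ⟨insert ⟨X, t, s⟩ P, S, Γ, σ⟩ ⟨P, S ∪ {.term X t s}, Γ, σ⟩
  | merTerm (Z₁ Z₂ : TVar) (t₁ s₁ t₂ s₂ : Term Sg)
      (S : Set (StoreEq Sg)) (Γ : Ctx Sg) (σ : Subst Sg) (π : Perm)
      (hne : StoreEq.term Z₁ t₁ s₁ ≠ .term Z₂ t₂ s₂)
      (hd₁ : StoreEq.term Z₁ t₁ s₁ ∉ S) (hd₂ : StoreEq.term Z₂ t₂ s₂ ∉ S)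
      (hπ : EqvmResult {(t₁, t₂), (s₁, s₂)} Γ π) :
      Step I ⟨∅, {.term Z₁ t₁ s₁, .term Z₂ t₂ s₂} ∪ S, Γ, σ⟩
        ⟨∅, {.term Z₁ t₁ s₁} ∪ S, Γ.subst (.singleT Z₂ (.var π Z₁)),
          σ.comp (.singleT Z₂ (.var π Z₁))⟩
  | merAtom (Z₁ Z₂ : AVar) (V₁ W₁ V₂ W₂ : Susp)
      (S : Set (StoreEq Sg)) (Γ : Ctx Sg) (σ : Subst Sg) (π : Perm)
      (hne : StoreEq.atom (Sg := Sg) Z₁ V₁ W₁ ≠ .atom Z₂ V₂ W₂)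
      (hd₁ : StoreEq.atom Z₁ V₁ W₁ ∉ S) (hd₂ : StoreEq.atom Z₂ V₂ W₂ ∉ S)
      (hπ : EqvmResult {(.susp V₁, .susp V₂), (.susp W₁, .susp W₂)} Γ π) :
      Step I ⟨∅, {.atom Z₁ V₁ W₁, .atom Z₂ V₂ W₂} ∪ S, Γ, σ⟩
        ⟨∅, {.atom Z₁ V₁ W₁} ∪ S, Γ.subst (.singleA Z₂ (.mk π Z₁)),
          σ.comp (.singleA Z₂ (.mk π Z₁))⟩
  /- Associative decomposition: `t = f(t₁, …, tₙ)` and `s = f(s₁, …, sₘ)` in flattened form,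
  `t' = f(t₁, …, tₖ)`, `t'' = f(tₖ₊₁, …, tₙ)`, and likewise `s'`, `s''`, where `f(r)` is `r`. -/
  | decA (X : TVar) (f : Sg.Bin) (hf : Sg.theory f = .A) (t s t' t'' s' s'' : Term Sg)
      (P : Set (AUEq Sg)) (S : Set (StoreEq Sg)) (Γ : Ctx Sg) (σ : Subst Sg) (Y₁ Y₂ : TVar)
      (ht : t.flat f = t'.flat f ++ t''.flat f) (hs : s.flat f = s'.flat f ++ s''.flat f)
      (hd : (⟨X, t, s⟩ : AUEq Sg) ∉ P)
      (hne : Y₁ ≠ Y₂)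
      (hY₁ : FreshT I ⟨insert ⟨X, t, s⟩ P, S, Γ, σ⟩ Y₁)
      (hY₂ : FreshT I ⟨insert ⟨X, t, s⟩ P, S, Γ, σ⟩ Y₂) :
      Step I ⟨insert ⟨X, t, s⟩ P, S, Γ, σ⟩
        ⟨{⟨Y₁, t', s'⟩, ⟨Y₂, t'', s''⟩} ∪ P, S, Γ,
          σ.comp (.singleT X (.bin f (.var .id Y₁) (.var .id Y₂)))⟩
  /- Commutative decomposition; the two choices of the index. -/
  | decC (X : TVar) (f : Sg.Bin) (hf : Sg.theory f = .C) (t₁ t₂ s₁ s₂ s' s'' : Term Sg)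
      (P : Set (AUEq Sg)) (S : Set (StoreEq Sg)) (Γ : Ctx Sg) (σ : Subst Sg) (Y₁ Y₂ : TVar)
      (hs : (s' = s₁ ∧ s'' = s₂) ∨ (s' = s₂ ∧ s'' = s₁))
      (hd : (⟨X, .bin f t₁ t₂, .bin f s₁ s₂⟩ : AUEq Sg) ∉ P)
      (hne : Y₁ ≠ Y₂)
      (hY₁ : FreshT I ⟨insert ⟨X, .bin f t₁ t₂, .bin f s₁ s₂⟩ P, S, Γ, σ⟩ Y₁)
      (hY₂ : FreshT I ⟨insert ⟨X, .bin f t₁ t₂, .bin f s₁ s₂⟩ P, S, Γ, σ⟩ Y₂) :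
      Step I ⟨insert ⟨X, .bin f t₁ t₂, .bin f s₁ s₂⟩ P, S, Γ, σ⟩
        ⟨{⟨Y₁, t₁, s'⟩, ⟨Y₂, t₂, s''⟩} ∪ P, S, Γ,
          σ.comp (.singleT X (.bin f (.var .id Y₁) (.var .id Y₂)))⟩
  /- Associative-commutative decomposition: as for `A`, up to reordering of the arguments. -/
  | decAC (X : TVar) (f : Sg.Bin) (hf : Sg.theory f = .AC) (t s t' t'' s' s'' : Term Sg)
      (P : Set (AUEq Sg)) (S : Set (StoreEq Sg)) (Γ : Ctx Sg) (σ : Subst Sg) (Y₁ Y₂ : TVar)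
      (ht : (t.flat f).Perm (t'.flat f ++ t''.flat f))
      (hs : (s.flat f).Perm (s'.flat f ++ s''.flat f))
      (hd : (⟨X, t, s⟩ : AUEq Sg) ∉ P)
      (hne : Y₁ ≠ Y₂)
      (hY₁ : FreshT I ⟨insert ⟨X, t, s⟩ P, S, Γ, σ⟩ Y₁)
      (hY₂ : FreshT I ⟨insert ⟨X, t, s⟩ P, S, Γ, σ⟩ Y₂) :
      Step I ⟨insert ⟨X, t, s⟩ P, S, Γ, σ⟩
        ⟨{⟨Y₁, t', s'⟩, ⟨Y₂, t'', s''⟩} ∪ P, S, Γ,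
          σ.comp (.singleT X (.bin f (.var .id Y₁) (.var .id Y₂)))⟩

end Terms

end NLA

namespace NLA

universe u

variable {Sg : Signature.{u}}

/-! ### Ground terms -/

-- Fix one side, left or right, and one ground instance G of the input term on that side. The
-- invariant, `Interp.Realizes`, says that some interpretation respects the current context,
-- satisfies the chosen side of every equation in P and S, and gives Xσ the value G modulo ≈_E.
-- Initially X itself receives the value G. Since every step preserves the existence of such an
-- interpretation (`Step.exists_realizes`), G is, up to ≈_E, an instance of Xσ in every reachable
-- context, which is the inclusion wanted. The two sides are treated separately and need no common
-- interpretation.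
--
-- Preservation rests on three facts. Fresh variables may take any value without disturbing the
-- state; so the new variables of a decomposition receive the values of the subterms on the chosen
-- side, and the bound variable of an abstraction receives an atom fresh for both abstractions.
-- Next, a binding {Z ↦ r} is harmless as soon as r already has the value of Z modulo ≈_E, because
-- evaluation and freshness respect ≈_E (`Term.interp_eqE`, `EqE.gfresh_iff`). Finally, for merging,
-- `Eqvm.sound` shows that π carries the values of the first equation to those of the second, so
-- that π·Z₁ and Z₂ already agree and the interpretation is kept.
--
-- Associativity enters through right-bracketed flattened forms (`GTerm.bracket_append`), and AC
-- also through their invariance under reordering (`GTerm.bracket_perm`).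

theorem GTerm.act_mul (p q : Equiv.Perm Atom) (T : GTerm Sg) :
    T.act (p * q) = (T.act q).act p := by
  induction T with
  | atom a => rfl
  | app f args ih => simp only [GTerm.act, ih]
  | bin f S T ihS ihT => simp only [GTerm.act, ihS, ihT]
  | lam a S ih => simp only [GTerm.act, ih, Equiv.Perm.mul_apply]

theorem GTerm.act_one (T : GTerm Sg) : T.act 1 = T := by
  induction T with
  | atom a => rfl
  | app f args ih => simp only [GTerm.act, ih]
  | bin f S T ihS ihT => simp only [GTerm.act, ihS, ihT]
  | lam a S ih => simp only [GTerm.act, ih, Equiv.Perm.one_apply]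

theorem GTerm.act_swap_swap (a b : Atom) (T : GTerm Sg) :
    (T.act (Equiv.swap a b)).act (Equiv.swap a b) = T := by
  rw [← GTerm.act_mul, Equiv.swap_mul_self, GTerm.act_one]

theorem GFresh.act {a : Atom} {T : GTerm Sg} (h : GFresh a T) (p : Equiv.Perm Atom) :
    GFresh (p a) (T.act p) := by
  induction h with
  | atom b h => exact .atom _ (fun e => h (p.injective e))
  | app f args _ ih => exact .app _ _ ih
  | bin f S T _ _ ihS ihT => exact .bin _ _ _ ihS ihT
  | lamSame T => exact .lamSame _
  | lam b T _ ih => exact .lam _ _ ih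

theorem GFresh.lam_iff {a b : Atom} {T : GTerm Sg} :
    GFresh a (.lam b T) ↔ a = b ∨ GFresh a T := by
  constructor
  · intro h
    cases h with
    | lamSame => exact .inl rfl
    | lam _ _ h => exact .inr h
  · rintro (rfl | h)
    · exact .lamSame _
    · exact .lam _ _ h

theorem GFresh.bin_iff {a : Atom} {f : Sg.Bin} {S T : GTerm Sg} :
    GFresh a (.bin f S T) ↔ GFresh a S ∧ GFresh a T :=
  ⟨fun h => by cases h with | bin _ _ _ hS hT => exact ⟨hS, hT⟩, fun h => .bin _ _ _ h.1 h.2⟩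

theorem GFresh.app_iff {a : Atom} {f : Sg.Free} {T : Fin (Sg.arity f) → GTerm Sg} :
    GFresh a (.app f T) ↔ ∀ i, GFresh a (T i) :=
  ⟨fun h => by cases h with | app _ _ h => exact h, fun h => .app _ _ h⟩

theorem GFresh.swap_iff {a b c : Atom} {T : GTerm Sg} :
    GFresh c (T.act (Equiv.swap a b)) ↔ GFresh (Equiv.swap a b c) T := by
  constructor
  · intro h
    have := h.act (Equiv.swap a b)
    rwa [GTerm.act_swap_swap] at this
  · intro h
    have := h.act (Equiv.swap a b)
    rwa [Equiv.swap_apply_self] at this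

/-- Freshness is compatible with `≈_E`. -/
theorem EqE.gfresh_iff {S T : GTerm Sg} (h : EqE S T) (c : Atom) :
    GFresh c S ↔ GFresh c T := by
  induction h with
  | atom a => rfl
  | app f S T _ ih => simp only [GFresh.app_iff, ih]
  | bin f S₁ S₂ T₁ T₂ _ _ ih₁ ih₂ => simp only [GFresh.bin_iff, ih₁, ih₂]
  | lamSame a S T _ ih => simp only [GFresh.lam_iff, ih]
  | lam a b S T _ hf ih =>
    rw [GFresh.lam_iff, GFresh.lam_iff, ih, GFresh.swap_iff]
    -- The swap moves only a and b: c = a is fresh on the left because it is bound there and on the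
    -- right by `hf`; for c = b the roles are exchanged.
    by_cases hca : c = a
    · subst hca; simp [hf]
    · by_cases hcb : c = b
      · subst hcb; simp [hf]
      · rw [Equiv.swap_apply_of_ne_of_ne hca hcb]; simp [hca, hcb]
  | comm f hf S T => simp only [GFresh.bin_iff, and_comm]
  | assoc f hf S T R => simp only [GFresh.bin_iff, and_assoc]
  | symm S T _ ih => exact ih.symm
  | trans S T R _ _ ih₁ ih₂ => exact ih₁.trans ih₂

/-- `≈_E` is equivariant. -/
theorem EqE.act {S T : GTerm Sg} (h : EqE S T) (p : Equiv.Perm Atom) :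
    EqE (S.act p) (T.act p) := by
  induction h with
  | atom a => exact .atom _
  | app f S T _ ih => exact .app _ _ _ ih
  | bin f S₁ S₂ T₁ T₂ _ _ ih₁ ih₂ => exact .bin _ _ _ _ _ ih₁ ih₂
  | lamSame a S T _ ih => exact .lamSame _ _ _ ih
  | lam a b S T _ hf ih =>
    refine .lam _ _ _ _ ?_ (hf.act p)
    -- Conjugation: p ∘ (a b) = (p a p b) ∘ p.
    rwa [← GTerm.act_mul, Equiv.mul_swap_eq_swap_mul, GTerm.act_mul] at ih
  | comm f hf S T => exact .comm _ hf _ _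
  | assoc f hf S T R => exact .assoc _ hf _ _ _
  | symm S T _ ih => exact .symm _ _ ih
  | trans S T R _ _ ih₁ ih₂ => exact .trans _ _ _ ih₁ ih₂

theorem EqE.symm' {S T : GTerm Sg} (h : EqE S T) : EqE T S := .symm _ _ h

theorem EqE.trans' {S T R : GTerm Sg} (h₁ : EqE S T) (h₂ : EqE T R) : EqE S R :=
  .trans _ _ _ h₁ h₂

theorem EqE.of_eq {S T : GTerm Sg} (h : S = T) : EqE S T := h ▸ EqE.refl S

/-- Renaming of a bound atom. -/
theorem EqE.lam_rename {a b : Atom} {T : GTerm Sg} (h : GFresh a (.lam b T)) :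
    EqE (.lam a (T.act (Equiv.swap b a))) (.lam b T) := by
  rcases GFresh.lam_iff.1 h with rfl | h
  · rw [Equiv.swap_self]
    exact .of_eq (congrArg _ (GTerm.act_one T))
  · exact .lam _ _ _ _ (by rw [Equiv.swap_comm]; exact .refl _) h

/-- Transitivity makes inversion on `EqE` useless, so an invariant is used instead: freshness
respects ≈_E, and b is fresh for every atom except itself. -/
theorem EqE.atom_iff {a b : Atom} : EqE (Sg := Sg) (.atom a) (.atom b) ↔ a = b := by
  refine ⟨fun h => ?_, fun h => .of_eq (by rw [h])⟩
  have h₁ := (h.gfresh_iff b).not.2 (fun h => by cases h with | atom _ h => exact h rfl)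
  by_contra hne
  exact h₁ (.atom _ (Ne.symm hne))

/-- Every ground term has only finitely many atoms that are not fresh for it. -/
theorem GFresh.finite_not (T : GTerm Sg) : {a | ¬ GFresh a T}.Finite := by
  induction T with
  | atom a =>
    refine (Set.finite_singleton a).subset fun b hb => ?_
    by_contra hne
    exact hb (.atom _ hne)
  | app f args ih =>
    refine (Set.finite_iUnion ih).subset fun b hb => ?_
    simpa [GFresh.app_iff] using hb
  | bin f S T ihS ihT =>
    refine (ihS.union ihT).subset fun b hb => ?_
    simp only [Set.mem_ofPred_eq, GFresh.bin_iff, Set.mem_union] at hb ⊢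
    tauto
  | lam a S ih =>
    refine ih.subset fun b hb => ?_
    simp only [Set.mem_ofPred_eq, GFresh.lam_iff] at hb ⊢
    tauto

/-! ### Right-bracketed applications of a binary symbol -/

/-- `f(t₁, f(t₂, … tₙ))`; the value for the empty list is irrelevant. -/
def GTerm.bracket (f : Sg.Bin) : List (GTerm Sg) → GTerm Sg
  | [] => .atom 0
  | [a] => a
  | a :: b :: l => .bin f a (bracket f (b :: l))

theorem GTerm.bracket_cons (f : Sg.Bin) (a : GTerm Sg) {l : List (GTerm Sg)} (hl : l ≠ []) :
    GTerm.bracket f (a :: l) = .bin f a (GTerm.bracket f l) := by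
  cases l with
  | nil => exact absurd rfl hl
  | cons b l => rfl

theorem GTerm.bracket_append {f : Sg.Bin} (hf : Sg.theory f = .A ∨ Sg.theory f = .AC)
    {l₁ l₂ : List (GTerm Sg)} (h₁ : l₁ ≠ []) (h₂ : l₂ ≠ []) :
    EqE (.bin f (GTerm.bracket f l₁) (GTerm.bracket f l₂)) (GTerm.bracket f (l₁ ++ l₂)) := by
  induction l₁ with
  | nil => exact absurd rfl h₁
  | cons a l₁ ih =>
    by_cases hl : l₁ = []
    · subst hl
      rw [List.singleton_append, bracket_cons f a h₂]
      exact .refl _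
    · rw [List.cons_append, bracket_cons f a hl, bracket_cons f a (by simp [hl])]
      exact (EqE.assoc f hf _ _ _).trans' (.bin _ _ _ _ _ (.refl _) (ih hl))

theorem GTerm.bracket_congr (f : Sg.Bin) {l₁ l₂ : List (GTerm Sg)} (h : List.Forall₂ EqE l₁ l₂) :
    EqE (GTerm.bracket f l₁) (GTerm.bracket f l₂) := by
  induction h with
  | nil => exact .refl _
  | @cons a b l₁ l₂ hab hl ih =>
    by_cases h₁ : l₁ = []
    · subst h₁
      cases hl
      exact hab
    · have h₂ : l₂ ≠ [] := by
        rintro rfl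
        cases hl
        exact h₁ rfl
      rw [bracket_cons f a h₁, bracket_cons f b h₂]
      exact .bin _ _ _ _ _ hab ih

theorem GTerm.bracket_perm {f : Sg.Bin} (hf : Sg.theory f = .AC) {l₁ l₂ : List (GTerm Sg)}
    (h : l₁.Perm l₂) : EqE (GTerm.bracket f l₁) (GTerm.bracket f l₂) := by
  induction h with
  | nil => exact .refl _
  | @cons a l₁ l₂ hl ih =>
    by_cases h₁ : l₁ = []
    · subst h₁
      rw [hl.nil_eq]
      exact .refl _
    · have h₂ : l₂ ≠ [] := by
        rintro rfl
        exact h₁ hl.eq_nil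
      rw [bracket_cons f a h₁, bracket_cons f a h₂]
      exact .bin _ _ _ _ _ (.refl _) ih
  | swap a b l =>
    by_cases hl : l = []
    · subst hl
      exact .comm _ (.inr hf) _ _
    · rw [bracket_cons f b (List.cons_ne_nil a l), bracket_cons f a hl,
        bracket_cons f a (List.cons_ne_nil b l), bracket_cons f b hl]
      -- b(al) = (ba)l = (ab)l = a(bl).
      exact (EqE.assoc f (.inr hf) _ _ _).symm'.trans'
        ((EqE.bin _ _ _ _ _ (.comm _ (.inr hf) _ _) (.refl _)).trans' (.assoc f (.inr hf) _ _ _))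
  | trans _ _ ih₁ ih₂ => exact ih₁.trans' ih₂

theorem GTerm.bracket_act (f : Sg.Bin) (p : Equiv.Perm Atom) {l : List (GTerm Sg)} (hl : l ≠ []) :
    (GTerm.bracket f l).act p = GTerm.bracket f (l.map (GTerm.act p)) := by
  induction l with
  | nil => exact absurd rfl hl
  | cons a l ih =>
    by_cases h : l = []
    · subst h; rfl
    · rw [bracket_cons f a h, List.map_cons, bracket_cons f _ (by simpa using h), ← ih h]
      rfl

/-! ### Interpretation of terms -/

theorem Perm.interp_comp (ρ : Interp Sg) : ∀ π π' : Perm,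
    (π.comp π').interp ρ = π.interp ρ * π'.interp ρ
  | .id, π' => by simp [Perm.comp, Perm.interp]
  | .swap W₁ W₂ π, π' => by simp [Perm.comp, Perm.interp, Perm.interp_comp ρ π π', mul_assoc]

theorem Susp.interp_act (ρ : Interp Sg) (π : Perm) (W : Susp) :
    (W.act π).interp ρ = π.interp ρ (W.interp ρ) := by
  cases W
  simp [Susp.act, Susp.interp, Perm.interp_comp]

theorem Term.interp_act (ρ : Interp Sg) (π : Perm) (t : Term Sg) :
    (t.act π).interp ρ = (t.interp ρ).act (π.interp ρ) := by
  induction t with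
  | susp W => simp only [Term.act, Term.interp, GTerm.act, Susp.interp_act]
  | var π' X => simp only [Term.act, Term.interp, Perm.interp_comp, GTerm.act_mul]
  | app f args ih => simp only [Term.act, Term.interp, GTerm.act, ih]
  | bin f s t ihs iht => simp only [Term.act, Term.interp, GTerm.act, ihs, iht]
  | lam W s ih => simp only [Term.act, Term.interp, GTerm.act, Susp.interp_act, ih]

theorem Susp.interp_ofVar (ρ : Interp Sg) (A : AVar) : (Susp.ofVar A).interp ρ = ρ.onA A := by
  simp [Susp.ofVar, Susp.interp, Perm.interp]

theorem Perm.interp_swapping (ρ : Interp Sg) (W₁ W₂ : Susp) :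
    (Perm.swapping W₁ W₂).interp ρ = Equiv.swap (W₁.interp ρ) (W₂.interp ρ) := by
  simp [Perm.swapping, Perm.interp]

theorem Term.interp_var_id (ρ : Interp Sg) (X : TVar) :
    (Term.var .id X : Term Sg).interp ρ = ρ.onT X := by
  simp [Term.interp, Perm.interp, GTerm.act_one]

mutual
theorem Perm.interp_congr {ρ ρ' : Interp Sg} :
    ∀ π : Perm, (∀ A ∈ π.av, ρ'.onA A = ρ.onA A) → π.interp ρ' = π.interp ρ
  | .id, _ => by simp [Perm.interp]
  | .swap W₁ W₂ π, h => by
    simp only [Perm.av, Set.mem_union] at h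
    rw [Perm.interp, Perm.interp, Susp.interp_congr W₁ fun A hA => h A (.inl (.inl hA)),
      Susp.interp_congr W₂ fun A hA => h A (.inl (.inr hA)),
      Perm.interp_congr π fun A hA => h A (.inr hA)]
theorem Susp.interp_congr {ρ ρ' : Interp Sg} :
    ∀ W : Susp, (∀ A ∈ W.av, ρ'.onA A = ρ.onA A) → W.interp ρ' = W.interp ρ
  | .mk π A, h => by
    simp only [Susp.av, Set.mem_insert_iff] at h
    rw [Susp.interp, Susp.interp, h A (.inl rfl), Perm.interp_congr π fun A hA => h A (.inr hA)]
end

/-- Interpretations with the same values for the atom-variables and equal values modulo `≈_E` for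
the term-variables of a term interpret it by terms that are equal modulo `≈_E`. -/
theorem Term.interp_eqE {ρ ρ' : Interp Sg} (t : Term Sg)
    (hA : ∀ A ∈ t.av, ρ'.onA A = ρ.onA A) (hT : ∀ X ∈ t.tv, EqE (ρ'.onT X) (ρ.onT X)) :
    EqE (t.interp ρ') (t.interp ρ) := by
  induction t with
  | susp W => exact .of_eq (by rw [Term.interp, Term.interp, Susp.interp_congr W hA])
  | var π X =>
    rw [Term.interp, Term.interp, Perm.interp_congr π hA]
    exact (hT X rfl).act _
  | app f args ih =>
    exact .app _ _ _ fun i => ih i (fun A h => hA A (Set.mem_iUnion.2 ⟨i, h⟩))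
      (fun X h => hT X (Set.mem_iUnion.2 ⟨i, h⟩))
  | bin f s t ihs iht =>
    exact .bin _ _ _ _ _ (ihs (fun A h => hA A (.inl h)) (fun X h => hT X (.inl h)))
      (iht (fun A h => hA A (.inr h)) (fun X h => hT X (.inr h)))
  | lam W s ih =>
    rw [Term.interp, Term.interp, Susp.interp_congr W fun A h => hA A (.inl h)]
    exact .lamSame _ _ _ (ih (fun A h => hA A (.inr h)) hT)

/-- The exact form, for variables that are merely left untouched: values of old terms can then be
rewritten literally after fresh variables receive values. -/
theorem Term.interp_congr {ρ ρ' : Interp Sg} (t : Term Sg)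
    (hA : ∀ A ∈ t.av, ρ'.onA A = ρ.onA A) (hT : ∀ X ∈ t.tv, ρ'.onT X = ρ.onT X) :
    t.interp ρ' = t.interp ρ := by
  induction t with
  | susp W => rw [Term.interp, Term.interp, Susp.interp_congr W hA]
  | var π X => rw [Term.interp, Term.interp, Perm.interp_congr π hA, hT X rfl]
  | app f args ih =>
    simp only [Term.interp]
    congr 1
    funext i
    exact ih i (fun A h => hA A (Set.mem_iUnion.2 ⟨i, h⟩))
      (fun X h => hT X (Set.mem_iUnion.2 ⟨i, h⟩))
  | bin f s t ihs iht =>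
    rw [Term.interp, Term.interp, ihs (fun A h => hA A (.inl h)) (fun X h => hT X (.inl h)),
      iht (fun A h => hA A (.inr h)) (fun X h => hT X (.inr h))]
  | lam W s ih =>
    rw [Term.interp, Term.interp, Susp.interp_congr W fun A h => hA A (.inl h),
      ih (fun A h => hA A (.inr h)) hT]

/-- The interpretation `σ ρ`. -/
def Subst.interp (σ : Subst Sg) (ρ : Interp Sg) : Interp Sg :=
  ⟨fun A => (σ.onA A).interp ρ, fun X => (σ.onT X).interp ρ⟩

mutual
theorem Perm.interp_subst (σ : Subst Sg) (ρ : Interp Sg) :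
    ∀ π : Perm, (π.subst σ).interp ρ = π.interp (σ.interp ρ)
  | .id => by simp [Perm.subst, Perm.interp]
  | .swap W₁ W₂ π => by
    rw [Perm.subst, Perm.interp, Perm.interp, Susp.interp_subst σ ρ W₁, Susp.interp_subst σ ρ W₂,
      Perm.interp_subst σ ρ π]
theorem Susp.interp_subst (σ : Subst Sg) (ρ : Interp Sg) :
    ∀ W : Susp, (W.subst σ).interp ρ = W.interp (σ.interp ρ)
  | .mk π A => by
    rw [Susp.subst, Susp.interp_act, Susp.interp, Perm.interp_subst σ ρ π]
    rfl
end

/-- Turns every extension of σ by a rule into a change of interpretation. -/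
theorem Term.interp_subst (σ : Subst Sg) (ρ : Interp Sg) (t : Term Sg) :
    (t.subst σ).interp ρ = t.interp (σ.interp ρ) := by
  induction t with
  | susp W => simp only [Term.subst, Term.interp, Susp.interp_subst]
  | var π X => simp only [Term.subst, Term.interp, Term.interp_act, Perm.interp_subst, Subst.interp]
  | app f args ih => simp only [Term.subst, Term.interp, ih]
  | bin f s t ihs iht => simp only [Term.subst, Term.interp, ihs, iht]
  | lam W s ih => simp only [Term.subst, Term.interp, Susp.interp_subst, ih]

/-! ### Flattened forms -/

theorem Term.flat_ne_nil (f : Sg.Bin) (t : Term Sg) : t.flat f ≠ [] := by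
  induction t with
  | bin g s t ihs iht =>
    rw [Term.flat]
    split_ifs <;> simp [ihs]
  | _ => simp [Term.flat]

/-- Flattening discards only nodes labelled f, hence no variables. The pieces in the A- and AC-rules
are known only through their flattened forms, and this shows that they contain no new variables. -/
theorem Term.mem_tv_iff_flat (f : Sg.Bin) (t : Term Sg) (X : TVar) :
    X ∈ t.tv ↔ ∃ u ∈ t.flat f, X ∈ u.tv := by
  induction t with
  | bin g s t ihs iht =>
    rw [Term.flat]
    split_ifs
    · simp only [Term.tv, Set.mem_union, ihs, iht, List.mem_append, or_and_right, exists_or]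
    · simp
  | _ => simp [Term.flat]

/-- A term is equal modulo `E` to its flattened form, bracketed to the right. -/
theorem Term.interp_eqE_bracket {f : Sg.Bin} (hf : Sg.theory f = .A ∨ Sg.theory f = .AC)
    (ρ : Interp Sg) (t : Term Sg) :
    EqE (t.interp ρ) (GTerm.bracket f ((t.flat f).map (Term.interp ρ))) := by
  induction t with
  | bin g s t ihs iht =>
    rw [Term.flat]
    split_ifs with h
    · subst h
      rw [List.map_append]
      exact (EqE.bin _ _ _ _ _ ihs iht).trans' (GTerm.bracket_append hf
        (by simpa using Term.flat_ne_nil g s) (by simpa using Term.flat_ne_nil g t))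
    · exact .refl _
  | _ => exact .refl _

theorem Term.interp_act_eqE_bracket {f : Sg.Bin} (hf : Sg.theory f = .A ∨ Sg.theory f = .AC)
    (ρ : Interp Sg) (p : Equiv.Perm Atom) (t : Term Sg) :
    EqE ((t.interp ρ).act p)
      (GTerm.bracket f ((t.flat f).map fun u => (u.interp ρ).act p)) := by
  refine ((Term.interp_eqE_bracket hf ρ t).act p).trans' (.of_eq ?_)
  rw [GTerm.bracket_act f p (by simpa using Term.flat_ne_nil f t), List.map_map]
  rfl

/-- The flattened form of f(t', t'') is the concatenation of the two lists, so both sides have the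
same bracketed form up to reordering. -/
theorem Term.interp_eqE_bin_of_perm {f : Sg.Bin} (hf : Sg.theory f = .AC) (ρ : Interp Sg)
    {t t' t'' : Term Sg} (h : (t.flat f).Perm (t'.flat f ++ t''.flat f)) :
    EqE (t.interp ρ) (.bin f (t'.interp ρ) (t''.interp ρ)) := by
  have h₁ := Term.interp_eqE_bracket (.inr hf) ρ (.bin f t' t'')
  rw [Term.flat, if_pos rfl] at h₁
  exact (Term.interp_eqE_bracket (.inr hf) ρ t).trans'
    ((GTerm.bracket_perm hf (h.map _)).trans' h₁.symm')

theorem Term.interp_eqE_bin_of_eq {f : Sg.Bin} (hf : Sg.theory f = .A) (ρ : Interp Sg)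
    {t t' t'' : Term Sg} (h : t.flat f = t'.flat f ++ t''.flat f) :
    EqE (t.interp ρ) (.bin f (t'.interp ρ) (t''.interp ρ)) := by
  have h₁ := Term.interp_eqE_bracket (.inl hf) ρ (.bin f t' t'')
  rw [Term.flat, if_pos rfl, ← h] at h₁
  exact (Term.interp_eqE_bracket (.inl hf) ρ t).trans' h₁.symm'

/-! ### Finiteness of the sets of variables -/

mutual
theorem Perm.finite_av : ∀ π : Perm, π.av.Finite
  | .id => by simp [Perm.av]
  | .swap W₁ W₂ π => by
    simpa only [Perm.av] using ((Susp.finite_av W₁).union (Susp.finite_av W₂)).union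
      (Perm.finite_av π)
theorem Susp.finite_av : ∀ W : Susp, W.av.Finite
  | .mk π A => by simpa only [Susp.av] using (Perm.finite_av π).insert A
end

theorem Term.finite_av (t : Term Sg) : t.av.Finite := by
  induction t with
  | susp W => exact Susp.finite_av W
  | var π X => exact Perm.finite_av π
  | app f args ih => exact Set.finite_iUnion ih
  | bin f s t ihs iht => exact ihs.union iht
  | lam W s ih => exact (Susp.finite_av W).union ih

theorem Term.finite_tv (t : Term Sg) : t.tv.Finite := by
  induction t with
  | susp W => exact Set.finite_empty
  | var π X => exact Set.finite_singleton X
  | app f args ih => exact Set.finite_iUnion ih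
  | bin f s t ihs iht => exact ihs.union iht
  | lam W s ih => exact ih

theorem Ctx.finite_av {Γ : Ctx Sg} (h : Γ.Finite) : (Ctx.av Γ).Finite :=
  (h.biUnion fun c _ => (Susp.finite_av c.W).union (Term.finite_av c.s)).subset
    fun _ ⟨_, hc, hA⟩ => Set.mem_biUnion hc hA

theorem Ctx.finite_tv {Γ : Ctx Sg} (h : Γ.Finite) : (Ctx.tv Γ).Finite :=
  (h.biUnion fun c _ => Term.finite_tv c.s).subset fun _ ⟨_, hc, hX⟩ => Set.mem_biUnion hc hX

theorem EqvProblem.finite_av {Ψ : EqvProblem Sg} (h : Ψ.Finite) : (EqvProblem.av Ψ).Finite :=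
  (h.biUnion fun e _ => (Term.finite_av e.1).union (Term.finite_av e.2)).subset
    fun _ ⟨_, he, hA⟩ => Set.mem_biUnion he hA

theorem EqvProblem.finite_tv {Ψ : EqvProblem Sg} (h : Ψ.Finite) : (EqvProblem.tv Ψ).Finite :=
  (h.biUnion fun e _ => (Term.finite_tv e.1).union (Term.finite_tv e.2)).subset
    fun _ ⟨_, he, hX⟩ => Set.mem_biUnion he hX

/-- There is an atom that is not in a given finite set and fresh for finitely many terms. -/
theorem exists_gfresh {B : Set Atom} (hB : B.Finite) {F : Set (GTerm Sg)} (hF : F.Finite) :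
    ∃ a, a ∉ B ∧ ∀ T ∈ F, GFresh a T := by
  obtain ⟨a, ha⟩ := (hB.union (hF.biUnion fun T _ => GFresh.finite_not T)).exists_notMem
  simp only [Set.mem_union, Set.mem_iUnion, Set.mem_ofPred_eq, not_or, not_exists, not_not] at ha
  exact ⟨a, ha.1, ha.2⟩

/-! ### Soundness of the equivariance algorithm -/

theorem Interp.Respects.congr {ρ ρ' : Interp Sg} {Γ : Ctx Sg} (h : ρ.Respects Γ)
    (hA : ∀ A ∈ Ctx.av Γ, ρ'.onA A = ρ.onA A) (hT : ∀ X ∈ Ctx.tv Γ, ρ'.onT X = ρ.onT X) :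
    ρ'.Respects Γ := by
  intro c hc
  rw [Susp.interp_congr c.W fun A h => hA A ⟨c, hc, .inl h⟩,
    Term.interp_congr c.s (fun A h => hA A ⟨c, hc, .inr h⟩) fun X h => hT X ⟨c, hc, h⟩]
  exact h c hc

/-- Change of the value of one atom-variable. -/
def Interp.updateA (ρ : Interp Sg) (A : AVar) (a : Atom) : Interp Sg :=
  ⟨Function.update ρ.onA A a, ρ.onT⟩

theorem Interp.updateA_of_ne (ρ : Interp Sg) {A B : AVar} (a : Atom) (h : B ≠ A) :
    (ρ.updateA A a).onA B = ρ.onA B := Function.update_of_ne h _ _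

theorem Interp.updateA_self (ρ : Interp Sg) (A : AVar) (a : Atom) :
    (ρ.updateA A a).onA A = a := Function.update_self _ _ _

theorem Term.interp_updateA (ρ : Interp Sg) {A : AVar} (a : Atom) {t : Term Sg} (h : A ∉ t.av) :
    t.interp (ρ.updateA A a) = t.interp ρ :=
  Term.interp_congr t (fun _ hB => ρ.updateA_of_ne a fun e => h (e ▸ hB)) fun _ _ => rfl

theorem Susp.interp_updateA (ρ : Interp Sg) {A : AVar} (a : Atom) {W : Susp} (h : A ∉ W.av) :
    W.interp (ρ.updateA A a) = W.interp ρ :=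
  Susp.interp_congr W fun _ hB => ρ.updateA_of_ne a fun e => h (e ▸ hB)

/-- Equality of abstractions can be checked after renaming to a fresh atom. -/
theorem EqE.lam_act_of_fresh {p : Equiv.Perm Atom} {a b c : Atom} {T S : GTerm Sg}
    (hT : GFresh a (.lam b T)) (hS : GFresh a (.lam c S)) (hp : p a = a)
    (h : EqE ((T.act (Equiv.swap b a)).act p) (S.act (Equiv.swap c a))) :
    EqE (.lam (p b) (T.act p)) (.lam c S) := by
  have h₁ := (EqE.lam_rename hT).act p
  simp only [GTerm.act, hp] at h₁
  exact h₁.symm'.trans' ((EqE.lamSame _ _ _ h).trans' (EqE.lam_rename hS))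

/-- Induction on the run, each decomposition being read backwards as a congruence or an identity of
E. The interpretation is generalized because the abstraction case uses the induction hypothesis at a
modified one. Finiteness of the equations and of the context leaves an atom to choose there. -/
theorem Eqvm.sound {π : Perm} {Ψ : EqvProblem Sg} {Δ : Ctx Sg} (h : Eqvm π Ψ Δ)
    (hΨ : Ψ.Finite) (hΔ : Δ.Finite) (ρ : Interp Sg) (hρ : ρ.Respects Δ) :
    ∀ e ∈ Ψ, EqE ((e.1.interp ρ).act (π.interp ρ)) (e.2.interp ρ) := by
  induction h generalizing ρ with
  | answer Ψ Δ _ hπ =>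
    intro e he
    have := hπ e he ρ hρ
    rwa [Term.interp_act] at this
  | eqAbs W₁ W₂ t s Ψ Δ A hd hA hAπ h ih =>
    have hfA := (EqvProblem.finite_av hΨ).union (Ctx.finite_av hΔ)
    have hfT := (EqvProblem.finite_tv hΨ).union (Ctx.finite_tv hΔ)
    -- The value for A: it satisfies all constraints added by the rule, and is moreover fresh for
    -- the two abstractions themselves.
    obtain ⟨a, ha, haF⟩ := exists_gfresh (hfA.image ρ.onA)
      ((hfT.image ρ.onT).union (Set.toFinite
        {(Term.lam W₁ t).interp ρ, (Term.lam W₂ s).interp ρ}))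
    have hAv : ∀ e ∈ insert (Term.lam W₁ t, Term.lam W₂ s) Ψ, A ∉ e.1.av ∧ A ∉ e.2.av :=
      fun e he => ⟨fun h => hA (.inl ⟨e, he, .inl h⟩), fun h => hA (.inl ⟨e, he, .inr h⟩)⟩
    have hρ' : (ρ.updateA A a).Respects ({c | ∃ B ∈ EqvProblem.av
          (insert (Term.lam W₁ t, Term.lam W₂ s) Ψ) ∪ Ctx.av Δ,
              c = ⟨.ofVar A, .susp (.ofVar B)⟩} ∪
          {c | ∃ X ∈ EqvProblem.tv (insert (Term.lam W₁ t, Term.lam W₂ s) Ψ) ∪ Ctx.tv Δ,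
              c = ⟨.ofVar A, .var .id X⟩} ∪ Δ) := by
      rintro c ((⟨B, hB, rfl⟩ | ⟨X, hX, rfl⟩) | hc)
      · have hBA : B ≠ A := fun e => hA (e ▸ hB)
        simp only [Term.interp, Susp.interp_ofVar, Interp.updateA_self,
          Interp.updateA_of_ne ρ a hBA]
        exact .atom _ fun e => ha ⟨B, hB, e.symm⟩
      · simp only [Term.interp_var_id, Susp.interp_ofVar, Interp.updateA_self]
        exact haF _ (.inl ⟨X, hX, rfl⟩)
      · exact hρ.congr (fun B hB => ρ.updateA_of_ne (A := A) a fun e => hA (.inr (e ▸ hB)))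
          (fun _ _ => rfl) c hc
    have hfin : Ψ.Finite := hΨ.subset (Set.subset_insert _ _)
    have key := ih ((hfin.insert _).insert _) (((hfA.image _).union (hfT.image _)).union hΔ |>.subset
      (by
        rintro c ((⟨B, hB, rfl⟩ | ⟨X, hX, rfl⟩) | hc)
        · exact .inl (.inl ⟨B, hB, rfl⟩)
        · exact .inl (.inr ⟨X, hX, rfl⟩)
        · exact .inr hc)) _ hρ'
    -- Since π does not mention A, its value is unaffected by the choice of a.
    have hπ : π.interp (ρ.updateA A a) = π.interp ρ :=
      Perm.interp_congr π fun B hB => ρ.updateA_of_ne a fun e => hAπ (e ▸ hB)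
    rw [hπ] at key
    rintro e (rfl | he)
    · have hl := hAv _ (.inl rfl)
      simp only [Term.av, Set.mem_union, not_or] at hl
      obtain ⟨⟨hW₁, ht⟩, hW₂, hs⟩ := hl
      have k₁ := key _ (.inl rfl)
      -- The auxiliary equation A ≼ A says that π fixes a, so π commutes with renaming the bound
      -- atom to a.
      have k₂ := key _ (.inr (.inl rfl))
      simp only [Term.interp, GTerm.act, Susp.interp_ofVar, Interp.updateA_self,
        EqE.atom_iff] at k₂
      simp only [Term.interp_act, Perm.interp_swapping, Susp.interp_ofVar, Interp.updateA_self,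
        Term.interp_updateA ρ a ht, Term.interp_updateA ρ a hs,
        Susp.interp_updateA ρ a hW₁, Susp.interp_updateA ρ a hW₂] at k₁
      exact EqE.lam_act_of_fresh (haF _ (.inr (.inl rfl))) (haF _ (.inr (.inr rfl))) k₂ k₁
    · have k := key e (.inr (.inr he))
      rwa [Term.interp_updateA ρ a (hAv e (.inr he)).1,
        Term.interp_updateA ρ a (hAv e (.inr he)).2] at k
  | eqf f t s Ψ Δ hd h ih =>
    have key := ih ((Set.finite_range _).union (hΨ.subset (Set.subset_insert _ _))) hΔ ρ hρ
    rintro e (rfl | he)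
    · exact .app _ _ _ fun i => key _ (.inl ⟨i, rfl⟩)
    · exact key e (.inr he)
  | eqfA f hf k hk t s ts ss ht hs Ψ Δ hd h ih =>
    have key := ih ((Set.finite_range _).union (hΨ.subset (Set.subset_insert _ _))) hΔ ρ hρ
    rintro e (rfl | he)
    · refine (Term.interp_act_eqE_bracket (.inl hf) ρ _ _).trans'
        (.trans' (GTerm.bracket_congr f ?_) (Term.interp_eqE_bracket (.inl hf) ρ _).symm')
      simp only [ht, hs, List.map_ofFn, List.forall₂_iff_get, List.length_ofFn, List.get_ofFn,
        true_and]
      intro i h₁ h₂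
      exact key _ (.inl ⟨_, rfl⟩)
    · exact key e (.inr he)
  | eqfC₁ f hf t₁ t₂ s₁ s₂ Ψ Δ hd h ih =>
    have key := ih (((hΨ.subset (Set.subset_insert _ _)).insert _).insert _) hΔ ρ hρ
    rintro e (rfl | he)
    · exact .bin _ _ _ _ _ (key _ (.inl rfl)) (key _ (.inr (.inl rfl)))
    · exact key e (.inr (.inr he))
  | eqfC₂ f hf t₁ t₂ s₁ s₂ Ψ Δ hd h ih =>
    have key := ih (((hΨ.subset (Set.subset_insert _ _)).insert _).insert _) hΔ ρ hρ
    rintro e (rfl | he)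
    · exact (EqE.bin _ _ _ _ _ (key _ (.inl rfl)) (key _ (.inr (.inl rfl)))).trans'
        (.comm _ (.inl hf) _ _)
    · exact key e (.inr (.inr he))
  | eqfAC f hf t s t₁ sᵢ t' s' l₁ l₂ hlen ht hs hs' Ψ Δ hd h ih =>
    have key := ih (((hΨ.subset (Set.subset_insert _ _)).insert _).insert _) hΔ ρ hρ
    rintro e (rfl | he)
    · have e₁ : EqE (t.interp ρ) (.bin f (t₁.interp ρ) (t'.interp ρ)) := by
        refine (Term.interp_eqE_bracket (.inr hf) ρ t).trans' ?_
        rw [ht, List.map_cons, GTerm.bracket_cons _ _ (by simpa using Term.flat_ne_nil f t')]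
        exact .bin _ _ _ _ _ (.refl _) (Term.interp_eqE_bracket (.inr hf) ρ t').symm'
      have e₂ : EqE (s.interp ρ) (.bin f (sᵢ.interp ρ) (s'.interp ρ)) := by
        refine ((Term.interp_eqE_bracket (.inr hf) ρ s).trans' (GTerm.bracket_perm hf
          (l₂ := (sᵢ :: s'.flat f).map (Term.interp ρ)) ?_)).trans' ?_
        · rw [hs, hs']
          exact List.Perm.map _ List.perm_middle
        · rw [List.map_cons, GTerm.bracket_cons _ _ (by simpa using Term.flat_ne_nil f s')]
          exact .bin _ _ _ _ _ (.refl _) (Term.interp_eqE_bracket (.inr hf) ρ s').symm'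
      exact (e₁.act _).trans' (.trans'
        (.bin _ _ _ _ _ (key _ (.inl rfl)) (key _ (.inr (.inl rfl)))) e₂.symm')
    · exact key e (.inr (.inr he))

/-- An interpretation respecting the context respects one of the disjuncts, and π is the answer of a
run on each of them. -/
theorem EqvmResult.sound {Ψ : EqvProblem Sg} {Γ : Ctx Sg} {π : Perm} (h : EqvmResult Ψ Γ π)
    (hΨ : Ψ.Finite) (ρ : Interp Sg) (hρ : ρ.Respects Γ) :
    ∀ e ∈ Ψ, EqE ((e.1.interp ρ).act (π.interp ρ)) (e.2.interp ρ) := by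
  obtain ⟨D, hD, hΓ, hE⟩ := h
  obtain ⟨Δ, hΔ, hρΔ⟩ := (hΓ ρ).1 hρ
  exact (hE Δ hΔ).sound hΨ (hD Δ hΔ).1 ρ hρΔ

/-! ### Soundness of the anti-unification algorithm -/

/-- The left (`true`) or the right (`false`) component. -/
def side {α : Type*} (b : Bool) (x y : α) : α := bif b then x else y

/-- `ρ` satisfies the left (or right) equations of the set `P` of unsolved equations. -/
def Interp.SolvesP (b : Bool) (ρ : Interp Sg) (P : Set (AUEq Sg)) : Prop :=
  ∀ e ∈ P, EqE (ρ.onT e.X) ((side b e.t e.s).interp ρ)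

/-- `ρ` satisfies the left (or right) equation of an equation in the store. -/
def Interp.SolvesStoreEq (b : Bool) (ρ : Interp Sg) : StoreEq Sg → Prop
  | .term X t s => EqE (ρ.onT X) ((side b t s).interp ρ)
  | .atom C W₁ W₂ => ρ.onA C = (side b W₁ W₂).interp ρ

/-- `ρ` satisfies the left (or right) equations of a state and its freshness context, and
interprets `X σ` by `G`. -/
structure Interp.Realizes (b : Bool) (X : TVar) (G : GTerm Sg) (ρ : Interp Sg) (st : State Sg) :
    Prop where
  context : ρ.Respects st.Γ
  unsolved : ρ.SolvesP b st.P
  store : ∀ e ∈ st.S, ρ.SolvesStoreEq b e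
  value : EqE ((st.σ.onT X).interp ρ) G

/-- `ρ` and `ρ'` coincide on the variables of the state and on `X`. -/
structure Interp.AgreesOn (X : TVar) (st : State Sg) (ρ ρ' : Interp Sg) : Prop where
  onA : ∀ A ∈ st.av, ρ'.onA A = ρ.onA A
  onT : ∀ Z ∈ insert X st.tv, ρ'.onT Z = ρ.onT Z

theorem side_term_av {b : Bool} {t s : Term Sg} {A : AVar} (h : A ∈ (side b t s).av) :
    A ∈ t.av ∪ s.av := by
  cases b
  · exact .inr h
  · exact .inl h

theorem side_term_tv {b : Bool} {t s : Term Sg} {Z : TVar} (h : Z ∈ (side b t s).tv) :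
    Z ∈ t.tv ∪ s.tv := by
  cases b
  · exact .inr h
  · exact .inl h

theorem side_susp_av {b : Bool} {V W : Susp} {A : AVar} (h : A ∈ (side b V W).av) :
    A ∈ V.av ∪ W.av := by
  cases b
  · exact .inr h
  · exact .inl h

namespace Interp

variable {b : Bool} {X : TVar} {G : GTerm Sg} {ρ ρ' : Interp Sg} {st : State Sg}

theorem AgreesOn.interp_eq (h : AgreesOn X st ρ ρ') {t : Term Sg} (hA : t.av ⊆ st.av)
    (hT : t.tv ⊆ insert X st.tv) : t.interp ρ' = t.interp ρ :=
  Term.interp_congr t (fun A hAt => h.onA A (hA hAt)) fun Z hZ => h.onT Z (hT hZ)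

theorem AgreesOn.unsolved_eq (h : AgreesOn X st ρ ρ') {e : AUEq Sg} (he : e ∈ st.P) :
    (side b e.t e.s).interp ρ' = (side b e.t e.s).interp ρ :=
  h.interp_eq (fun _ hA => .inl (.inl (.inl ⟨e, he, side_term_av hA⟩)))
    (fun _ hZ => .inr (.inl (.inl (.inl ⟨e, he, .inr (side_term_tv hZ)⟩))))

/-- An interpretation realizing a state still realizes it after a change of the values of
variables that do not occur in it. -/
theorem Realizes.congr (h : Realizes b X G ρ st) (ha : AgreesOn X st ρ ρ') :
    Realizes b X G ρ' st where
  context := h.context.congr (fun A hA => ha.onA A (.inl (.inr hA)))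
    fun Z hZ => ha.onT Z (.inr (.inl (.inr hZ)))
  unsolved e he := by
    rw [ha.unsolved_eq he, ha.onT _ (.inr (.inl (.inl (.inl ⟨e, he, .inl rfl⟩))))]
    exact h.unsolved e he
  store := by
    rintro (⟨Z, t, s⟩ | ⟨C, V, W⟩) he
    · have hT : ∀ Y ∈ (StoreEq.term Z t s).tv, ρ'.onT Y = ρ.onT Y :=
        fun Y hY => ha.onT Y (.inr (.inl (.inl (.inr ⟨_, he, hY⟩))))
      have hA : ∀ A ∈ (StoreEq.term Z t s).av, ρ'.onA A = ρ.onA A :=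
        fun A hA => ha.onA A (.inl (.inl (.inr ⟨_, he, hA⟩)))
      rw [SolvesStoreEq, hT Z (.inl rfl), Term.interp_congr _ (fun A hAt => hA A (side_term_av hAt))
        fun Y hY => hT Y (.inr (side_term_tv hY))]
      exact h.store _ he
    · have hA : ∀ A ∈ (StoreEq.atom (Sg := Sg) C V W).av, ρ'.onA A = ρ.onA A :=
        fun A hA => ha.onA A (.inl (.inl (.inr ⟨_, he, hA⟩)))
      rw [SolvesStoreEq, hA C (.inl rfl),
        Susp.interp_congr _ fun A hAW => hA A (.inr (side_susp_av hAW))]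
      exact h.store _ he
  value := by
    rw [ha.interp_eq (fun A hA => .inr (.inr ⟨X, hA⟩)) fun Z hZ => ?_]
    · exact h.value
    · by_cases hX : st.σ.onT X = .var .id X
      · rw [hX] at hZ
        exact .inl hZ
      · exact .inr (.inr (.inr ⟨X, hX, hZ⟩))

end Interp

-- Effect of single bindings on interpretations

theorem Subst.interp_comp_onT (σ γ : Subst Sg) (X : TVar) (ρ : Interp Sg) :
    ((σ.comp γ).onT X).interp ρ = (σ.onT X).interp (γ.interp ρ) :=
  Term.interp_subst γ ρ _

theorem Subst.singleT_interp_onA (Z : TVar) (r : Term Sg) (ρ : Interp Sg) (A : AVar) :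
    ((Subst.singleT Z r).interp ρ).onA A = ρ.onA A :=
  Susp.interp_ofVar ρ A

/-- `{Z ↦ r}` does not change, modulo `≈_E`, an interpretation of `Z` by the value of `r`. -/
theorem Subst.singleT_interp_onT {Z : TVar} {r : Term Sg} {ρ : Interp Sg}
    (h : EqE (r.interp ρ) (ρ.onT Z)) (Y : TVar) :
    EqE (((Subst.singleT Z r).interp ρ).onT Y) (ρ.onT Y) := by
  by_cases hY : Y = Z
  · subst hY
    simpa [Subst.interp, Subst.singleT] using h
  · simpa [Subst.interp, Subst.singleT, Function.update_of_ne hY, Subst.id, Term.interp_var_id]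
      using EqE.refl _

theorem Term.interp_singleT {Z : TVar} {r : Term Sg} {ρ : Interp Sg}
    (h : EqE (r.interp ρ) (ρ.onT Z)) (t : Term Sg) :
    EqE (t.interp ((Subst.singleT Z r).interp ρ)) (t.interp ρ) :=
  Term.interp_eqE t (fun A _ => Subst.singleT_interp_onA Z r ρ A)
    fun Y _ => Subst.singleT_interp_onT h Y

theorem Interp.Respects.singleT {Z : TVar} {r : Term Sg} {ρ : Interp Sg} {Γ : Ctx Sg}
    (hρ : ρ.Respects Γ) (h : EqE (r.interp ρ) (ρ.onT Z)) :
    ρ.Respects (Ctx.subst (.singleT Z r) Γ) := by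
  rintro _ ⟨c, hc, rfl⟩
  simp only [Constraint.subst, Susp.interp_subst, Term.interp_subst]
  rw [Susp.interp_congr c.W fun A _ => Subst.singleT_interp_onA Z r ρ A,
    (Term.interp_singleT h c.s).gfresh_iff]
  exact hρ c hc

/-- Atoms are compared literally, so here the interpretation is unchanged, not just modulo ≈_E. -/
theorem Subst.singleA_interp {Z : AVar} {W : Susp} {ρ : Interp Sg}
    (h : W.interp ρ = ρ.onA Z) : (Subst.singleA (Sg := Sg) Z W).interp ρ = ρ := by
  rw [Interp.mk.injEq]
  refine ⟨funext fun A => ?_, funext fun Y => Term.interp_var_id ρ Y⟩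
  by_cases hA : A = Z
  · subst hA
    simpa [Subst.interp, Subst.singleA] using h
  · simp [Subst.interp, Subst.singleA, Function.update_of_ne hA, Subst.id, Susp.interp_ofVar]

-- Carrying a realizing interpretation through a rule

namespace Interp

variable {b : Bool} {X₀ : TVar} {G : GTerm Sg} {ρ ρ' : Interp Sg}

/-- The common part of the rules that replace an unsolved equation `X : t ≜ s` and extend the
substitution by `{X ↦ r}`. -/
theorem Realizes.replace {X : TVar} {t s : Term Sg} {P : Set (AUEq Sg)} {S : Set (StoreEq Sg)}
    {Γ : Ctx Sg} {σ : Subst Sg} {r : Term Sg} {P' : Set (AUEq Sg)} {S' : Set (StoreEq Sg)}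
    {Γ' : Ctx Sg} (h : Realizes b X₀ G ρ ⟨insert ⟨X, t, s⟩ P, S, Γ, σ⟩)
    (ha : AgreesOn X₀ ⟨insert ⟨X, t, s⟩ P, S, Γ, σ⟩ ρ ρ')
    (hr : EqE (r.interp ρ') ((side b t s).interp ρ))
    (hP : ρ'.SolvesP b P') (hS : ∀ e ∈ S', ρ'.SolvesStoreEq b e) (hΓ : ρ'.Respects Γ') :
    Realizes b X₀ G ρ' ⟨P' ∪ P, S ∪ S', Γ ∪ Γ', σ.comp (.singleT X r)⟩ := by
  have h' := h.congr ha
  refine ⟨?_, ?_, ?_, ?_⟩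
  · rintro c (hc | hc)
    exacts [h'.context c hc, hΓ c hc]
  · rintro e (he | he)
    exacts [hP e he, h'.unsolved e (.inr he)]
  · rintro e (he | he)
    exacts [h'.store e he, hS e he]
  · refine .trans' (.of_eq (Subst.interp_comp_onT _ _ _ _)) ((Term.interp_singleT ?_ _).trans'
      h'.value)
    refine hr.trans' ?_
    rw [← ha.unsolved_eq (b := b) (e := ⟨X, t, s⟩) (.inl rfl)]
    exact (h'.unsolved ⟨X, t, s⟩ (.inl rfl)).symm'

/-- As `Realizes.replace`, for rules that add nothing to the store and to the context. -/
theorem Realizes.replace_unsolved {X : TVar} {t s : Term Sg} {P : Set (AUEq Sg)}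
    {S : Set (StoreEq Sg)} {Γ : Ctx Sg} {σ : Subst Sg} {r : Term Sg} {P' : Set (AUEq Sg)}
    (h : Realizes b X₀ G ρ ⟨insert ⟨X, t, s⟩ P, S, Γ, σ⟩)
    (ha : AgreesOn X₀ ⟨insert ⟨X, t, s⟩ P, S, Γ, σ⟩ ρ ρ')
    (hr : EqE (r.interp ρ') ((side b t s).interp ρ)) (hP : ρ'.SolvesP b P') :
    Realizes b X₀ G ρ' ⟨P' ∪ P, S, Γ, σ.comp (.singleT X r)⟩ := by
  simpa using h.replace (S' := ∅) (Γ' := ∅) ha hr hP (by simp) (by simp [Respects])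

theorem AgreesOn.refl (X : TVar) (st : State Sg) (ρ : Interp Sg) : AgreesOn X st ρ ρ :=
  ⟨fun _ _ => rfl, fun _ _ => rfl⟩

/-- Change of the values of a family of term-variables. -/
noncomputable def extendT {ι : Type*} (ρ : Interp Sg) (Y : ι → TVar) (T : ι → GTerm Sg) :
    Interp Sg :=
  ⟨ρ.onA, Function.extend Y T ρ.onT⟩

theorem extendT_apply {ι : Type*} (ρ : Interp Sg) {Y : ι → TVar} (hY : Function.Injective Y)
    (T : ι → GTerm Sg) (i : ι) : (ρ.extendT Y T).onT (Y i) = T i :=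
  hY.extend_apply _ _ _

/-- Freshness also excludes the variables of the input, in particular the root variable X. -/
theorem AgreesOn.extendT {ι : Type*} {I : Input Sg} {st : State Sg} (ρ : Interp Sg)
    {Y : ι → TVar} (hY : ∀ i, FreshT I st (Y i)) (T : ι → GTerm Sg) :
    AgreesOn I.eqn.X st ρ (ρ.extendT Y T) := by
  refine ⟨fun _ _ => rfl, fun Z hZ => Function.extend_apply' _ _ _ ?_⟩
  rintro ⟨i, rfl⟩
  rcases hZ with hZ | hZ
  · exact (hY i).2.1 (.inl hZ)
  · exact (hY i).2.2 hZ

theorem AgreesOn.updateA {I : Input Sg} {st : State Sg} (ρ : Interp Sg)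
    {C : AVar} (hC : FreshA I st C) (a : Atom) :
    AgreesOn X₀ st ρ (ρ.updateA C a) :=
  ⟨fun _ hA => ρ.updateA_of_ne a fun e => hC.2.2 (e ▸ hA), fun _ _ => rfl⟩

/-- Replacement of `X : t ≜ s` by the equations `Yᵢ : tᵢ ≜ sᵢ` with fresh `Yᵢ`, where the
variables of `tᵢ` and `sᵢ` occur in `t` and `s`. -/
theorem Realizes.decompose {ι : Type*} {I : Input Sg} {X : TVar} {t s : Term Sg}
    {P : Set (AUEq Sg)} {S : Set (StoreEq Sg)} {Γ : Ctx Sg} {σ : Subst Sg} {r : Term Sg}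
    {Y : ι → TVar} {ts ss : ι → Term Sg}
    (h : Realizes b I.eqn.X G ρ ⟨insert ⟨X, t, s⟩ P, S, Γ, σ⟩)
    (hinj : Function.Injective Y)
    (hY : ∀ i, FreshT I ⟨insert ⟨X, t, s⟩ P, S, Γ, σ⟩ (Y i))
    (htv : ∀ i, (ts i).tv ⊆ t.tv) (hsv : ∀ i, (ss i).tv ⊆ s.tv)
    (hr : ∀ ρ' : Interp Sg, (∀ i, ρ'.onT (Y i) = (side b (ts i) (ss i)).interp ρ) →
      EqE (r.interp ρ') ((side b t s).interp ρ)) :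
    ∃ ρ', Realizes b I.eqn.X G ρ' ⟨Set.range (fun i => (⟨Y i, ts i, ss i⟩ : AUEq Sg)) ∪ P, S, Γ,
      σ.comp (.singleT X r)⟩ := by
  have ha := AgreesOn.extendT ρ hY fun i => (side b (ts i) (ss i)).interp ρ
  refine ⟨_, h.replace_unsolved ha (hr _ fun i => extendT_apply ρ hinj _ i) ?_⟩
  rintro _ ⟨i, rfl⟩
  have hi : (side b (ts i) (ss i)).interp (ρ.extendT Y fun i => (side b (ts i) (ss i)).interp ρ) =
      (side b (ts i) (ss i)).interp ρ :=
    Term.interp_congr _ (fun _ _ => rfl) fun Z hZ =>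
      ha.onT Z (.inr (.inl (.inl (.inl ⟨_, .inl rfl, .inr
        ((side_term_tv hZ).imp (fun h => htv i h) (fun h => hsv i h))⟩))))
  exact .of_eq ((extendT_apply ρ hinj _ i).trans hi.symm)

/-- The case of two new equations in `Realizes.decompose`. -/
theorem Realizes.decompose_bin {I : Input Sg} {X : TVar} {t s : Term Sg}
    {P : Set (AUEq Sg)} {S : Set (StoreEq Sg)} {Γ : Ctx Sg} {σ : Subst Sg} {f : Sg.Bin}
    {Y₁ Y₂ : TVar} {t' t'' s' s'' : Term Sg}
    (h : Realizes b I.eqn.X G ρ ⟨insert ⟨X, t, s⟩ P, S, Γ, σ⟩) (hne : Y₁ ≠ Y₂)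
    (hY₁ : FreshT I ⟨insert ⟨X, t, s⟩ P, S, Γ, σ⟩ Y₁)
    (hY₂ : FreshT I ⟨insert ⟨X, t, s⟩ P, S, Γ, σ⟩ Y₂)
    (htv : t'.tv ⊆ t.tv ∧ t''.tv ⊆ t.tv) (hsv : s'.tv ⊆ s.tv ∧ s''.tv ⊆ s.tv)
    (ht : EqE (t.interp ρ) (.bin f (t'.interp ρ) (t''.interp ρ)))
    (hs : EqE (s.interp ρ) (.bin f (s'.interp ρ) (s''.interp ρ))) :
    ∃ ρ', Realizes b I.eqn.X G ρ' ⟨{⟨Y₁, t', s'⟩, ⟨Y₂, t'', s''⟩} ∪ P, S, Γ,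
      σ.comp (.singleT X (.bin f (.var .id Y₁) (.var .id Y₂)))⟩ := by
  -- The pair is indexed by `Bool`, with `true` for the first component.
  have key := h.decompose (r := .bin f (.var .id Y₁) (.var .id Y₂)) (Y := fun c => side c Y₁ Y₂)
    (ts := fun c => side c t' t'') (ss := fun c => side c s' s'')
    (by
      rintro (_ | _) (_ | _) e
      exacts [rfl, absurd e.symm hne, absurd e hne, rfl])
    (by rintro (_ | _); exacts [hY₂, hY₁]) (by rintro (_ | _); exacts [htv.2, htv.1])
    (by rintro (_ | _); exacts [hsv.2, hsv.1]) (by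
      intro ρ' hρ'
      have h₁ := hρ' true
      have h₂ := hρ' false
      simp only [side, cond_true, cond_false] at h₁ h₂
      simp only [Term.interp, Perm.interp, GTerm.act_one, h₁, h₂]
      cases b
      exacts [hs.symm', ht.symm'])
  have e : Set.range (fun c => (⟨side c Y₁ Y₂, side c t' t'', side c s' s''⟩ : AUEq Sg)) =
      {⟨Y₁, t', s'⟩, ⟨Y₂, t'', s''⟩} := by
    ext e
    simp [side]
    tauto
  rwa [e] at key

end Interp

-- Preservation of the invariant by the steps, and the theorem

theorem Term.tv_subset_of_flat {f : Sg.Bin} {t u : Term Sg} (h : t.flat f ⊆ u.flat f) :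
    t.tv ⊆ u.tv := fun Z hZ => by
  rw [Term.mem_tv_iff_flat f] at hZ ⊢
  exact hZ.imp fun v hv => ⟨h hv.1, hv.2⟩

theorem Term.tv_subset_of_mem_flat {f : Sg.Bin} {t u : Term Sg} (h : t ∈ u.flat f) :
    t.tv ⊆ u.tv := fun _ hZ => (Term.mem_tv_iff_flat f u _).2 ⟨t, h, hZ⟩

/-- Every step of the algorithm preserves the existence of a realizing interpretation. -/
theorem Step.exists_realizes {I : Input Sg} {st st' : State Sg} (h : Step I st st') {b : Bool}
    {G : GTerm Sg} (hst : ∃ ρ : Interp Sg, ρ.Realizes b I.eqn.X G st) :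
    ∃ ρ : Interp Sg, ρ.Realizes b I.eqn.X G st' := by
  obtain ⟨ρ, hρ⟩ := hst
  cases h with
  | dec X f t s P S Γ σ Y hd hinj hY =>
    refine hρ.decompose hinj hY (fun i Z hZ => Set.mem_iUnion.2 ⟨i, hZ⟩)
      (fun i Z hZ => Set.mem_iUnion.2 ⟨i, hZ⟩) fun ρ' hρ' => ?_
    simp only [Term.interp, Perm.interp, GTerm.act_one, hρ']
    cases b <;> exact .refl _
  | decFlat X f hf m hm t s r ts ss P S Γ σ Y ht hs hr hd hinj hY =>
    refine hρ.decompose hinj hY (fun i => Term.tv_subset_of_mem_flat (f := f) (by simp [ht]))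
      (fun i => Term.tv_subset_of_mem_flat (f := f) (by simp [hs])) fun ρ' hρ' => ?_
    -- Whatever the bracketing of r, its flattened arguments are the Yᵢ, whose values are those of
    -- the arguments on the chosen side.
    refine ((Term.interp_eqE_bracket hf ρ' r).trans' (.of_eq (congrArg _ ?_))).trans'
      (Term.interp_eqE_bracket hf ρ _).symm'
    cases b
    · simp only [side, cond_false, hs, hr, List.map_ofFn]
      exact congrArg _ (funext fun i => (Term.interp_var_id ρ' _).trans (hρ' i))
    · simp only [side, cond_true, ht, hr, List.map_ofFn]
      exact congrArg _ (funext fun i => (Term.interp_var_id ρ' _).trans (hρ' i))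
  | abs X W₁ W₂ t s P S Γ σ Y C hd hY hC =>
    -- Both abstractions are avoided, although only one side is followed, because Γ receives both
    -- constraints.
    obtain ⟨c, -, hc⟩ := exists_gfresh (Set.finite_empty (α := Atom)) (Set.toFinite
      {(Term.lam W₁ t).interp ρ, (Term.lam W₂ s).interp ρ})
    have hc₁ := hc _ (.inl rfl)
    have hc₂ := hc _ (.inr rfl)
    -- The value of Y: the body on the chosen side with its bound atom renamed to c.
    set T : GTerm Sg := (side b (t.interp ρ) (s.interp ρ)).act
      (Equiv.swap (side b (W₁.interp ρ) (W₂.interp ρ)) c) with hT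
    have ha₁ : Interp.AgreesOn I.eqn.X _ ρ (ρ.updateA C c) := .updateA ρ hC c
    have ha₂ := Interp.AgreesOn.extendT (ι := Unit) (ρ.updateA C c) (fun _ => hY) fun _ => T
    have ha : Interp.AgreesOn I.eqn.X _ ρ ((ρ.updateA C c).extendT (fun _ : Unit => Y) fun _ => T) :=
      ⟨fun A hA => (ha₂.onA A hA).trans (ha₁.onA A hA),
        fun Z hZ => (ha₂.onT Z hZ).trans (ha₁.onT Z hZ)⟩
    have hYT : ((ρ.updateA C c).extendT (fun _ : Unit => Y) fun _ => T).onT Y = T :=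
      Interp.extendT_apply _ (Y := fun _ : Unit => Y) (fun _ _ _ => rfl) _ ()
    have hCc : ((ρ.updateA C c).extendT (fun _ : Unit => Y) fun _ => T).onA C = c :=
      ρ.updateA_self C c
    set ρ' := (ρ.updateA C c).extendT (fun _ : Unit => Y) fun _ => T
    have e₁ : (Term.lam W₁ t).interp ρ' = (Term.lam W₁ t).interp ρ :=
      ha.unsolved_eq (b := true) (.inl rfl)
    have e₂ : (Term.lam W₂ s).interp ρ' = (Term.lam W₂ s).interp ρ :=
      ha.unsolved_eq (b := false) (.inl rfl)
    have key := hρ.replace (r := .lam (.ofVar C) (.var .id Y)) (S' := ∅)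
      (P' := {⟨Y, t.act (.swapping W₁ (.ofVar C)), s.act (.swapping W₂ (.ofVar C))⟩})
      (Γ' := {⟨.ofVar C, .lam W₁ t⟩, ⟨.ofVar C, .lam W₂ s⟩}) ha ?_ ?_ (by simp) ?_
    · rw [Set.union_empty] at key
      exact ⟨ρ', key⟩
    · rw [Term.interp, Term.interp_var_id, Susp.interp_ofVar, hYT, hCc, hT]
      cases b
      · exact EqE.lam_rename hc₂
      · exact EqE.lam_rename hc₁
    · rintro _ rfl
      simp only [hYT, hT]
      simp only [Term.interp, GTerm.lam.injEq] at e₁ e₂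
      cases b
      · simp only [side, cond_false, Term.interp_act, Perm.interp_swapping, Susp.interp_ofVar, hCc,
          e₂]
        exact .refl _
      · simp only [side, cond_true, Term.interp_act, Perm.interp_swapping, Susp.interp_ofVar, hCc,
          e₁]
        exact .refl _
    · rintro _ (rfl | rfl)
      · rw [Susp.interp_ofVar, hCc, e₁]
        exact hc₁
      · rw [Susp.interp_ofVar, hCc, e₂]
        exact hc₂
  | susAA X W₁ W₂ P S Γ σ hd h =>
    have key := hρ.replace_unsolved (r := .susp W₁) (P' := ∅) (.refl _ _ ρ)
      (by cases b; exacts [h ρ hρ.context, .refl _]) (by simp [Interp.SolvesP])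
    rw [Set.empty_union] at key
    exact ⟨ρ, key⟩
  | susYY X π₁ π₂ Y P S Γ σ hd h =>
    have key := hρ.replace_unsolved (r := .var π₁ Y) (P' := ∅) (.refl _ _ ρ)
      (by cases b; exacts [h ρ hρ.context, .refl _]) (by simp [Interp.SolvesP])
    rw [Set.empty_union] at key
    exact ⟨ρ, key⟩
  | solAB X W₁ W₂ P S Γ σ C hd h hC =>
    have ha : Interp.AgreesOn I.eqn.X _ ρ (ρ.updateA C ((side b W₁ W₂).interp ρ)) :=
      .updateA ρ hC _
    have hCc : (ρ.updateA C ((side b W₁ W₂).interp ρ)).onA C = (side b W₁ W₂).interp ρ :=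
      ρ.updateA_self C _
    set ρ' := ρ.updateA C ((side b W₁ W₂).interp ρ)
    have e₁ := ha.unsolved_eq (b := true) (e := ⟨X, .susp W₁, .susp W₂⟩) (.inl rfl)
    have e₂ := ha.unsolved_eq (b := false) (e := ⟨X, .susp W₁, .susp W₂⟩) (.inl rfl)
    simp only [side, cond_true, cond_false, Term.interp, GTerm.atom.injEq] at e₁ e₂
    have key := hρ.replace (r := .susp (.ofVar C)) (P' := ∅) (S' := {.atom C W₁ W₂})
      (Γ' := {⟨.ofVar C, .lam W₁ (.lam W₂ (.susp (.ofVar C)))⟩}) ha ?_ (by simp [Interp.SolvesP])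
      ?_ ?_
    · rw [Set.empty_union] at key
      exact ⟨ρ', key⟩
    · rw [Term.interp, Susp.interp_ofVar, hCc]
      cases b <;> exact .refl _
    · rintro _ rfl
      rw [Interp.SolvesStoreEq, hCc]
      cases b
      exacts [e₂.symm, e₁.symm]
    · rintro _ rfl
      simp only [Term.interp, Susp.interp_ofVar, hCc, e₁, e₂, GFresh.lam_iff]
      cases b
      -- C has the value of W₁ or of W₂, so one of the two binders captures it.
      exacts [.inr (.inl rfl), .inl rfl]
  | sol X t s P S Γ σ hd h =>
    refine ⟨ρ, hρ.context, fun e he => hρ.unsolved e (.inr he), ?_, hρ.value⟩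
    rintro e (he | rfl)
    · exact hρ.store e he
    · exact hρ.unsolved ⟨X, t, s⟩ (.inl rfl)
  | merTerm Z₁ Z₂ t₁ s₁ t₂ s₂ S Γ σ π hne hd₁ hd₂ hπ =>
    have h₁ : EqE (ρ.onT Z₁) ((side b t₁ s₁).interp ρ) := hρ.store _ (.inl (.inl rfl))
    have h₂ : EqE (ρ.onT Z₂) ((side b t₂ s₂).interp ρ) := hρ.store _ (.inl (.inr rfl))
    have hs := hπ.sound (Set.toFinite _) ρ hρ.context
    have h₃ : EqE (((side b t₁ s₁).interp ρ).act (π.interp ρ)) ((side b t₂ s₂).interp ρ) := by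
      cases b
      exacts [hs _ (.inr rfl), hs _ (.inl rfl)]
    -- The binding Z₂ ↦ π·Z₁ is already true under ρ, so ρ itself realizes the merged state.
    have h₄ : EqE ((Term.var π Z₁ : Term Sg).interp ρ) (ρ.onT Z₂) :=
      (h₁.act _).trans' (h₃.trans' h₂.symm')
    refine ⟨ρ, hρ.context.singleT h₄, hρ.unsolved, ?_, ?_⟩
    · rintro e (he | he)
      exacts [hρ.store e (.inl (.inl he)), hρ.store e (.inr he)]
    · exact .trans' (.of_eq (Subst.interp_comp_onT _ _ _ _))
        ((Term.interp_singleT h₄ _).trans' hρ.value)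
  | merAtom Z₁ Z₂ V₁ W₁ V₂ W₂ S Γ σ π hne hd₁ hd₂ hπ =>
    have h₁ : ρ.onA Z₁ = (side b V₁ W₁).interp ρ := hρ.store _ (.inl (.inl rfl))
    have h₂ : ρ.onA Z₂ = (side b V₂ W₂).interp ρ := hρ.store _ (.inl (.inr rfl))
    have hs := hπ.sound (Set.toFinite _) ρ hρ.context
    have h₃ : π.interp ρ ((side b V₁ W₁).interp ρ) = (side b V₂ W₂).interp ρ := by
      cases b
      exacts [EqE.atom_iff.1 (hs _ (.inr rfl)), EqE.atom_iff.1 (hs _ (.inl rfl))]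
    have h₄ : (Susp.mk π Z₁).interp ρ = ρ.onA Z₂ := by
      rw [Susp.interp, h₁, h₃, h₂]
    refine ⟨ρ, ?_, hρ.unsolved, ?_, ?_⟩
    · rintro _ ⟨c, hc, rfl⟩
      simp only [Constraint.subst, Susp.interp_subst, Term.interp_subst, Subst.singleA_interp h₄]
      exact hρ.context c hc
    · rintro e (he | he)
      exacts [hρ.store e (.inl (.inl he)), hρ.store e (.inr he)]
    · refine .trans' (.of_eq (Subst.interp_comp_onT _ _ _ _)) ?_
      rw [Subst.singleA_interp h₄]
      exact hρ.value
  | decA X f hf t s t' t'' s' s'' P S Γ σ Y₁ Y₂ ht hs hd hne hY₁ hY₂ =>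
    exact hρ.decompose_bin hne hY₁ hY₂
      ⟨Term.tv_subset_of_flat (f := f) (by simp [ht]),
        Term.tv_subset_of_flat (f := f) (by simp [ht])⟩
      ⟨Term.tv_subset_of_flat (f := f) (by simp [hs]),
        Term.tv_subset_of_flat (f := f) (by simp [hs])⟩
      (Term.interp_eqE_bin_of_eq hf ρ ht) (Term.interp_eqE_bin_of_eq hf ρ hs)
  | decC X f hf t₁ t₂ s₁ s₂ s' s'' P S Γ σ Y₁ Y₂ hs hd hne hY₁ hY₂ =>
    refine hρ.decompose_bin hne hY₁ hY₂ ⟨Set.subset_union_left, Set.subset_union_right⟩ ?_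
      (.refl _) ?_
    · rcases hs with ⟨rfl, rfl⟩ | ⟨rfl, rfl⟩
      exacts [⟨Set.subset_union_left, Set.subset_union_right⟩,
        ⟨Set.subset_union_right, Set.subset_union_left⟩]
    · rcases hs with ⟨rfl, rfl⟩ | ⟨rfl, rfl⟩
      exacts [.refl _, .comm _ (.inl hf) _ _]
  | decAC X f hf t s t' t'' s' s'' P S Γ σ Y₁ Y₂ ht hs hd hne hY₁ hY₂ =>
    have hl {u u' u'' : Term Sg} (hu : (u.flat f).Perm (u'.flat f ++ u''.flat f)) :
        u'.tv ⊆ u.tv ∧ u''.tv ⊆ u.tv :=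
      ⟨Term.tv_subset_of_flat fun _ hv => hu.mem_iff.2 (List.mem_append_left _ hv),
        Term.tv_subset_of_flat fun _ hv => hu.mem_iff.2 (List.mem_append_right _ hv)⟩
    exact hρ.decompose_bin hne hY₁ hY₂ (hl ht) (hl hs)
      (Term.interp_eqE_bin_of_perm hf ρ ht) (Term.interp_eqE_bin_of_perm hf ρ hs)

/-- A reachable state without unsolved equations describes the instances of both input terms. -/
theorem moreGeneral_of_derivation {Δ Γ₀ : Ctx Sg} {t s : Term Sg} {X : TVar}
    (hXt : X ∉ t.tv) (hXs : X ∉ s.tv) (hXΔ : X ∉ Ctx.tv Δ) (hΓ₀ : Γ₀ = ∅ ∨ Γ₀ = Δ) {st : State Sg}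
    (h : Relation.TransGen (Step ⟨Δ, ⟨X, t, s⟩⟩) ⟨{⟨X, t, s⟩}, ∅, Γ₀, Subst.id⟩ st) (b : Bool) :
    MoreGeneral st.Γ (st.σ.onT X) Δ (side b t s) := by
  rintro _ ⟨ρ, hρ, rfl⟩
  set G := (side b t s).interp ρ with hG
  have hX : X ∉ (side b t s).tv := fun h => (side_term_tv h).elim hXt hXs
  have hne {Z : TVar} (h : Z ≠ X) : Function.update ρ.onT X G Z = ρ.onT Z :=
    Function.update_of_ne h _ _
  -- Giving X the value G affects neither the input terms nor Δ, in which X does not occur.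
  have h₀ : (⟨ρ.onA, Function.update ρ.onT X G⟩ : Interp Sg).Realizes b X G
      ⟨{⟨X, t, s⟩}, ∅, Γ₀, Subst.id⟩ := by
    refine ⟨?_, ?_, by simp, .of_eq ?_⟩
    · rcases hΓ₀ with rfl | rfl
      · simp [Interp.Respects]
      · exact hρ.congr (fun _ _ => rfl) fun Z hZ => hne fun e => hXΔ (e ▸ hZ)
    · rintro _ rfl
      have hi : (side b t s).interp ⟨ρ.onA, Function.update ρ.onT X G⟩ = (side b t s).interp ρ :=
        Term.interp_congr _ (fun _ _ => rfl) fun Z hZ => hne fun e => hX (e ▸ hZ)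
      exact .of_eq ((Function.update_self _ _ _).trans hi.symm)
    · simp [Subst.id, Term.interp_var_id]
  obtain ⟨ρ', hρ'⟩ : ∃ ρ' : Interp Sg, ρ'.Realizes b X G st := by
    induction h with
    | single h => exact h.exists_realizes ⟨_, h₀⟩
    | tail _ h ih => exact h.exists_realizes ih
  exact ⟨ρ', hρ'.context, Quotient.sound hρ'.value.symm'⟩

end NLA

theorem mainTheorem1 {Sg : NLA.Signature} (Δ : NLA.Ctx Sg) (hΔ : Δ.Finite)
    (t s : NLA.Term Sg) (X : NLA.TVar)
    (hXt : X ∉ t.tv) (hXs : X ∉ s.tv) (hXΔ : X ∉ NLA.Ctx.tv Δ)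
    (Γ₀ : NLA.Ctx Sg) (hΓ₀ : Γ₀ = ∅ ∨ Γ₀ = Δ)
    (S : Set (NLA.StoreEq Sg)) (Γ : NLA.Ctx Sg) (σ : NLA.Subst Sg)
    (h : Relation.TransGen (NLA.Step ⟨Δ, ⟨X, t, s⟩⟩)
      ⟨{⟨X, t, s⟩}, ∅, Γ₀, NLA.Subst.id⟩ ⟨∅, S, Γ, σ⟩) :
    NLA.IsGeneralization Γ (σ.onT X) Δ t Δ s :=
  ⟨NLA.moreGeneral_of_derivation hXt hXs hXΔ hΓ₀ h true,
    NLA.moreGeneral_of_derivation hXt hXs hXΔ hΓ₀ h false⟩
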